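/- **Model.** Let $b\in\{1,2,\dots\}$, $K=2^{b-1}$, thresholds $0=t_0<t_1<\dots<t_{K-1}<t_K=+\infty$, representatives $0<\mu_1<\dots<\mu_K$, bins $\mathcal R_k=[t_{k-1},t_k)$, and let $Q(z)=\operatorname{sign}(z)\sum_{k=1}^K\mu_k\,I(|z|\in\mathcal R_k)$ be the resulting $b$-bit quantizer; let $\sigma\ge 0$. For every dimension $n\ge 1$ let $\mathcal K_n\subseteq\mathbb R^n$ be a set of signals, $x_u^{*}=x_u^{*,n}\in\mathcal K_n$ a vector with $\|x_u^{*}\|_2=1$, $m=m_n\ge 1$ an integer, and let $A\in\mathbb R^{m\times n}$ (with rows $a_1,\dots,a_m$) and $\varepsilon\in\mathbb R^m$ have jointly independent $N(0,1)$ entries. One observes $y_i=Q(\langle a_i,x_u^{*}\rangle+\sigma\varepsilon_i)$, $i=1,\dots,m$. Put $\mathcal C=\mathcal K_n\cap B_2^n$, where $B_2^n$ is the closed Euclidean unit ball, and let $\hat x\in\operatorname{argmin}_{x\in\mathcal C}-\langle A^{\top}y/m,\,x\rangle$ be any canonical linear estimator. **Quantities.** Let $\lambda=\mathbb E[\theta(g)g]$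 with $g\sim N(0,1)$ and $\theta(s)=\mathbb E[Q(s+\sigma\varepsilon_1)]$, so that $\mathbb E[y_1\mid a_1]=\theta(\langle a_1,x_u^{*}\rangle)$; let $\Psi=\sqrt{\mathbb E[y_1^2]}$. Let $\overline\Delta(\mathcal C)=\{\alpha(x-x_u^{*}):\alpha\ge 0,\ x\in\mathcal C\}\cap\mathbb S^{n-1}$ and let $w=w_n=\mathbb E\sup_{v\in\overline\Delta(\mathcal C)}|\langle g,v\rangle|$, $g\sim N(0,I_n)$, be its Gaussian width (equal to $0$ if $\overline\Delta(\mathcal C)$ is empty). **Theorem.** The number $\lambda$ is positive, and there is a constant $c>0$, depending only on the sub-Gaussian norm $\inf\{L>0:\mathbb E\exp(y_1^2/(L\Psi)^2)\le 2\}$ of $y_1/\Psi$, such that the following holds. If $\|x_u^{*,n}\|_\infty\to 0$ as $n\to\infty$ (condition (C)), then for all sufficiently large $n$, with probability at least $1-4\left(\exp(-w/2)+\exp(-cm)\right)$, every canonical linear estimator $\hat x$ satisfies $$\|\hat x-x_u^{*}\|_2\le 24\,\frac{\Psi}{\lambda}\,\frac{w}{\sqrt m}.$$ If moreover $w_n\to\infty$,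 then $1-4\left(\exp(-w/2)+\exp(-cm)\right)=1-o(1)-4\exp(-cm)$ as $n\to\infty$. -/

import Mathlib

open MeasureTheory ProbabilityTheory Filter Topology
open scoped Matrix RealInnerProductSpace

noncomputable section

namespace QuantCS

/-- The parameters of a symmetric `b`-bit scalar quantizer (`b ≥ 1`) with `K = 2 ^ (b - 1)` bins on
the half-line `[0, ∞)`: thresholds `0 = t 0 < t 1 < ⋯ < t K = ∞` and representatives
`0 < μ 0 < ⋯ < μ (K - 1)`, where `μ k` belongs to the bin `[t k, t (k + 1))`. -/
structure Quantizer (b : ℕ) where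
  /-- the thresholds, in increasing order -/
  t : Fin (2 ^ (b - 1) + 1) → EReal
  t_zero : t 0 = 0
  t_last : t (Fin.last _) = ⊤
  t_strictMono : StrictMono t
  /-- the representatives of the bins -/
  μ : Fin (2 ^ (b - 1)) → ℝ
  μ_pos : ∀ k, 0 < μ k
  μ_strictMono : StrictMono μ

namespace Quantizer

variable {b : ℕ} (Q : Quantizer b)

/-- The `k`-th bin `[t k, t (k + 1))`. -/
def bin (k : Fin (2 ^ (b - 1))) : Set ℝ :=
  {r : ℝ | Q.t k.castSucc ≤ (r : EReal) ∧ (r : EReal) < Q.t k.succ}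

/-- The quantization map `z ↦ sign z * ∑ₖ μₖ 1(|z| ∈ Rₖ)`. -/
def quantize (z : ℝ) : ℝ :=
  Real.sign z * ∑ k, (Q.bin k).indicator (fun _ => Q.μ k) |z|

end Quantizer

/-- The standard normal law `N(0,1)` on the real line. -/
abbrev stdNormal : Measure ℝ := gaussianReal 0 1

/-- `θ s = E[Q (s + σ ε)]` with `ε ∼ N(0,1)`. Since the noise is independent of the measurement
vector `a`, this is the map with `E[y | a] = θ ⟨a, x⟩`. -/
def theta {b : ℕ} (Q : Quantizer b) (σ s : ℝ) : ℝ :=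
  ∫ e, Q.quantize (s + σ * e) ∂stdNormal

/-- `λ = E[θ(g) g]` with `g ∼ N(0,1)`. -/
def lam {b : ℕ} (Q : Quantizer b) (σ : ℝ) : ℝ :=
  ∫ g, theta Q σ g * g ∂stdNormal

/-- A single observation as a function of the pair `p = (⟨a, x⟩, ε)`; for a unit vector `x` this
pair has the law `N(0,1) ⊗ N(0,1)`. -/
def singleObs {b : ℕ} (Q : Quantizer b) (σ : ℝ) (p : ℝ × ℝ) : ℝ :=
  Q.quantize (p.1 + σ * p.2)

/-- `Ψ = √(E[y²])`, the standard deviation of a single observation `y`. -/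
def Psi {b : ℕ} (Q : Quantizer b) (σ : ℝ) : ℝ :=
  √(∫ p, singleObs Q σ p ^ 2 ∂(stdNormal.prod stdNormal))

/-- The sub-Gaussian (Orlicz `ψ₂`) norm `inf {L > 0 : E[exp (X² / L²)] ≤ 2}`. -/
def subGaussianNorm {Ω : Type*} [MeasurableSpace Ω] (X : Ω → ℝ) (P : Measure Ω) : ℝ :=
  sInf {L : ℝ | 0 < L ∧ ∫⁻ ω, ENNReal.ofReal (Real.exp (X ω ^ 2 / L ^ 2)) ∂P ≤ 2}

/-- The sub-Gaussian norm of the normalized observation `y / Ψ`. -/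
def obsSubGaussianNorm {b : ℕ} (Q : Quantizer b) (σ : ℝ) : ℝ :=
  subGaussianNorm (fun p => singleObs Q σ p / Psi Q σ) (stdNormal.prod stdNormal)

/-- The entries of the random matrix `A` and of the random vector `ε` are jointly independent and
each of them has the law `N(0,1)`. -/
structure IsGaussianEnsemble {Ω : Type*} [MeasurableSpace Ω] {m n : ℕ}
    (A : Ω → Matrix (Fin m) (Fin n) ℝ) (ε : Ω → Fin m → ℝ) (P : Measure Ω) : Prop where
  indep : iIndepFun (fun (k : (Fin m × Fin n) ⊕ Fin m) (ω : Ω) =>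
    Sum.elim (fun ij => A ω ij.1 ij.2) (ε ω) k) P
  law_A : ∀ i j, HasLaw (fun ω => A ω i j) stdNormal P
  law_ε : ∀ i, HasLaw (fun ω => ε ω i) stdNormal P

/-- The observations `y i = Q (⟨a i, x⟩ + σ ε i)`, where `a i` is the `i`-th row of `A`. -/
def observations {b m n : ℕ} (Q : Quantizer b) (σ : ℝ) (x : EuclideanSpace ℝ (Fin n))
    (A : Matrix (Fin m) (Fin n) ℝ) (ε : Fin m → ℝ) : Fin m → ℝ :=
  fun i => Q.quantize ((A *ᵥ x.ofLp) i + σ * ε i)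

/-- `η = Aᵀ y / m`. -/
def eta {m n : ℕ} (A : Matrix (Fin m) (Fin n) ℝ) (y : Fin m → ℝ) : EuclideanSpace ℝ (Fin n) :=
  WithLp.toLp 2 ((m : ℝ)⁻¹ • (Aᵀ *ᵥ y))

/-- `C = K ∩ B₂ⁿ`, where `B₂ⁿ` is the closed Euclidean unit ball. -/
def feasibleSet {n : ℕ} (K : Set (EuclideanSpace ℝ (Fin n))) : Set (EuclideanSpace ℝ (Fin n)) :=
  K ∩ Metric.closedBall 0 1

/-- The set of all canonical linear estimators, `argmin_{x ∈ C} -⟨η, x⟩`. -/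
def linearEstimators {n : ℕ} (C : Set (EuclideanSpace ℝ (Fin n)))
    (η : EuclideanSpace ℝ (Fin n)) : Set (EuclideanSpace ℝ (Fin n)) :=
  {z | z ∈ C ∧ IsMinOn (fun x => -⟪η, x⟫) C z}

/-- The tangent cone `Δ(C; z) = {α (x - z) : α ≥ 0, x ∈ C}`. -/
def tangentCone {n : ℕ} (C : Set (EuclideanSpace ℝ (Fin n))) (z : EuclideanSpace ℝ (Fin n)) :
    Set (EuclideanSpace ℝ (Fin n)) :=
  {v | ∃ α : ℝ, 0 ≤ α ∧ ∃ x ∈ C, v = α • (x - z)}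

/-- The spherical part of the tangent cone, `Δ(C; z) ∩ Sⁿ⁻¹`. -/
def sphericalTangentCone {n : ℕ} (C : Set (EuclideanSpace ℝ (Fin n)))
    (z : EuclideanSpace ℝ (Fin n)) : Set (EuclideanSpace ℝ (Fin n)) :=
  tangentCone C z ∩ Metric.sphere 0 1

/-- The Gaussian width `w(S) = E[sup_{v ∈ S} |⟨g, v⟩|]` with `g ∼ N(0, Iₙ)`, for a bounded set
`S` (with value `0` for the empty set). -/
def gaussianWidth {n : ℕ} (S : Set (EuclideanSpace ℝ (Fin n))) : ℝ :=
  ∫ g, ⨆ v : S, |⟪g, (v : EuclideanSpace ℝ (Fin n))⟫|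
    ∂(stdGaussian (EuclideanSpace ℝ (Fin n)))

/-- The width `w(Δ̄(C; x))` of the spherical tangent cone of `C = K ∩ B₂ⁿ` at `x`. -/
def coneWidth {n : ℕ} (K : Set (EuclideanSpace ℝ (Fin n))) (x : EuclideanSpace ℝ (Fin n)) : ℝ :=
  gaussianWidth (sphericalTangentCone (feasibleSet K) x)

end QuantCS

end

open QuantCS

/-! ### Suprema of absolute inner products and damping along a direction -/

section SupAbsInner

variable {E : Type*} [NormedAddCommGroup E] [InnerProductSpace ℝ E]

/-! Write s = √(1 + σ²). The noisy measurement ⟨aᵢ, x⟩ + σ εᵢ equals s Nᵢ with Nᵢ standard normal,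
and by rotation invariance the pair (aᵢ, εᵢ) can be rebuilt from Nᵢ and an independent standard
Gaussian vector gᵢ, with aᵢ = (Nᵢ / s) x + D gᵢ, where D multiplies the x-component by σ / s
(`map_ensembleOf`). The observation is then Ψ p(Nᵢ) for the normalized response p, a function of Nᵢ
alone. Hence, exactly, η = Λ x + (Ψ / m) D (∑ p(Nᵢ) gᵢ) with Λ = Ψ / (m s) ∑ p(Nᵢ) Nᵢ.

Three events have to be controlled. Chernoff bounds give Λ ≥ λ / 2 and ∑ p(Nᵢ)² < 9m / 4 outside
exponentially small probability, with a rate depending only on the sub-Gaussian norm; this needs a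
lower bound on E[p(N) N] in terms of that norm (`le_integral_mul_self`). Conditionally on N, the sum
∑ p(Nᵢ) gᵢ is a standard Gaussian vector scaled by √(∑ p(Nᵢ)²), so the residual tested on the
spherical tangent cone is governed by the supremum defining the width w, which exceeds 4w with
probability at most exp(1 - w) (`measure_exists_dampedAlong_gt_le`). That tail comes from a
decoupling argument with two independent Gaussian vectors, based on the independence of X + Y and X
- Y.

On the good event a deterministic argument concludes: optimality of the estimator together with
‖xhat‖ ≤ 1 = ‖x‖ forces negative curvature of Λ⟨x, ·⟩ along the error, which the residual must
compensate (`norm_sub_le_of_mem_linearEstimators`). -/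

lemma abs_inner_le_iSup {S : Set E} (hS : ∀ v ∈ S, ‖v‖ ≤ 1) (g : E) (v : S) :
    |⟪g, (v : E)⟫| ≤ ⨆ v : S, |⟪g, (v : E)⟫| := by
  refine le_ciSup (f := fun v : S => |⟪g, (v : E)⟫|) ⟨‖g‖, ?_⟩ v
  rintro _ ⟨v, rfl⟩
  exact (abs_real_inner_le_norm _ _).trans (mul_le_of_le_one_right (norm_nonneg _) (hS v v.2))

lemma iSup_abs_inner_nonneg (S : Set E) (g : E) : 0 ≤ ⨆ v : S, |⟪g, (v : E)⟫| :=
  Real.iSup_nonneg fun _ => abs_nonneg _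

lemma iSup_abs_inner_add_le {S : Set E} (hS : ∀ v ∈ S, ‖v‖ ≤ 1) (g h : E) :
    ⨆ v : S, |⟪g + h, (v : E)⟫| ≤ (⨆ v : S, |⟪g, (v : E)⟫|) + ⨆ v : S, |⟪h, (v : E)⟫| := by
  refine Real.iSup_le (fun v => ?_)
    (add_nonneg (iSup_abs_inner_nonneg S g) (iSup_abs_inner_nonneg S h))
  rw [inner_add_left]
  exact (abs_add_le _ _).trans (add_le_add (abs_inner_le_iSup hS g v) (abs_inner_le_iSup hS h v))

lemma iSup_abs_inner_smul (S : Set E) {c : ℝ} (hc : 0 ≤ c) (g : E) :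
    ⨆ v : S, |⟪c • g, (v : E)⟫| = c * ⨆ v : S, |⟪g, (v : E)⟫| := by
  rw [Real.mul_iSup_of_nonneg hc]
  congr 1
  ext v
  rw [real_inner_smul_left, abs_mul, abs_of_nonneg hc]

lemma iSup_abs_inner_le_norm {S : Set E} (hS : ∀ v ∈ S, ‖v‖ ≤ 1) (g : E) :
    ⨆ v : S, |⟪g, (v : E)⟫| ≤ ‖g‖ :=
  Real.iSup_le (fun v => (abs_real_inner_le_norm _ _).trans
    (mul_le_of_le_one_right (norm_nonneg _) (hS v v.2))) (norm_nonneg _)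

lemma continuous_iSup_abs_inner {S : Set E} (hS : ∀ v ∈ S, ‖v‖ ≤ 1) :
    Continuous fun g : E => ⨆ v : S, |⟪g, (v : E)⟫| := by
  refine LipschitzWith.continuous (K := 1) (LipschitzWith.of_le_add fun g h => ?_)
  have h1 := iSup_abs_inner_add_le hS h (g - h)
  rw [add_sub_cancel] at h1
  rw [dist_eq_norm]
  linarith [iSup_abs_inner_le_norm hS (g - h)]

/-- The contraction multiplying the component along the unit vector `x` by `ρ`. -/
def dampedAlong (x : E) (ρ : ℝ) (g : E) : E := g - ((1 - ρ) * ⟪x, g⟫) • x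

/-- Symmetry of the damping map: the damping can be moved from the Gaussian vector to the test
vector, where it does not increase the norm. -/
lemma inner_dampedAlong (x : E) (ρ : ℝ) (g v : E) :
    ⟪dampedAlong x ρ g, v⟫ = ⟪dampedAlong x ρ v, g⟫ := by
  simp only [dampedAlong, inner_sub_left, real_inner_smul_left]
  rw [real_inner_comm v g]; ring

lemma norm_dampedAlong_le {x : E} (hx : ‖x‖ = 1) {ρ : ℝ} (h0 : 0 ≤ ρ) (h1 : ρ ≤ 1) (g : E) :
    ‖dampedAlong x ρ g‖ ≤ ‖g‖ := by
  refine le_of_sq_le_sq ?_ (norm_nonneg _)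
  have h2 : ‖dampedAlong x ρ g‖ ^ 2 = ‖g‖ ^ 2 - (1 - ρ ^ 2) * ⟪x, g⟫ ^ 2 := by
    rw [dampedAlong, norm_sub_sq_real, real_inner_smul_right, norm_smul, hx, real_inner_comm,
      mul_one, Real.norm_eq_abs, sq_abs]
    ring
  rw [h2]
  nlinarith [mul_nonneg (show 0 ≤ 1 - ρ ^ 2 by nlinarith) (sq_nonneg ⟪x, g⟫)]

end SupAbsInner

/-! ### Concentration of Gaussian suprema -/

section GaussianConcentration

variable {E : Type*} [NormedAddCommGroup E] [InnerProductSpace ℝ E] [FiniteDimensional ℝ E]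
  [MeasurableSpace E] [BorelSpace E]

lemma map_inner_stdGaussian (t : E) :
    (stdGaussian E).map (fun x => ⟪t, x⟫) = gaussianReal 0 (‖t‖ ^ 2).toNNReal := by
  have h := IsGaussian.map_eq_gaussianReal (μ := stdGaussian E) (innerSL ℝ t)
  rw [integral_strongDual_stdGaussian, variance_dual_stdGaussian, innerSL_apply_norm] at h
  exact h

lemma lintegral_exp_inner_stdGaussian (t : E) :
    ∫⁻ x, ENNReal.ofReal (Real.exp ⟪t, x⟫) ∂(stdGaussian E)
      = ENNReal.ofReal (Real.exp (‖t‖ ^ 2 / 2)) := by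
  have h := lintegral_map (μ := stdGaussian E) (g := fun x => ⟪t, x⟫)
    (f := fun r : ℝ => ENNReal.ofReal (Real.exp r)) (by fun_prop) (by fun_prop)
  rw [← h, map_inner_stdGaussian, ← ofReal_integral_eq_lintegral_ofReal]
  · have h2 := congrFun (mgf_id_gaussianReal (μ := 0) (v := (‖t‖ ^ 2).toNNReal)) 1
    simp only [mgf, id, one_mul] at h2
    rw [h2]
    simp
  · simpa using integrable_exp_mul_gaussianReal (μ := 0) (v := (‖t‖ ^ 2).toNNReal) 1
  · exact ae_of_all _ fun _ => (Real.exp_pos _).le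

/-- Given the first coordinate, the inner product is a centred Gaussian of variance at most r². -/
lemma lintegral_exp_inner_prod_stdGaussian {v : E → E} (hv : Measurable v) {r : ℝ}
    (hr : ∀ x, ‖v x‖ ≤ r) :
    ∫⁻ p, ENNReal.ofReal (Real.exp ⟪v p.1, p.2⟫) ∂((stdGaussian E).prod (stdGaussian E))
      ≤ ENNReal.ofReal (Real.exp (r ^ 2 / 2)) := by
  rw [lintegral_prod _ (by fun_prop)]
  simp_rw [lintegral_exp_inner_stdGaussian]
  calc _ ≤ ∫⁻ _ : E, ENNReal.ofReal (Real.exp (r ^ 2 / 2)) ∂(stdGaussian E) := by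
        refine lintegral_mono fun x => ENNReal.ofReal_le_ofReal (Real.exp_le_exp.2 ?_)
        have := hr x
        gcongr
    _ = _ := by simp

/-- X + Y and X - Y are independent, so given X + Y the exponent is a centred Gaussian of variance
at most 2. -/
lemma lintegral_exp_inner_rotated_stdGaussian {v : E → E} (hv : Measurable v)
    (hr : ∀ x, ‖v x‖ ≤ 1) :
    ∫⁻ p, ENNReal.ofReal (Real.exp ⟪v (p.1 + p.2), p.1 - p.2⟫)
      ∂((stdGaussian E).prod (stdGaussian E)) ≤ ENNReal.ofReal (Real.exp 1) := by
  have hs : √2 * (√2 / 2) = 1 := by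
    have := Real.mul_self_sqrt (show (0 : ℝ) ≤ 2 by norm_num)
    linarith
  -- Rotation by π/4 sends (X, Y) to (√2/2)(X + Y) and -(√2/2)(X - Y); the factors in `u` undo this
  -- scaling and sign.
  set u : E → E := fun x => (-√2) • v (√2 • x) with hu
  have hum : Measurable u := by fun_prop
  have h := lintegral_exp_inner_prod_stdGaussian hum (r := √2) (fun x => by
    simp only [hu, norm_smul, norm_neg, Real.norm_eq_abs, abs_of_nonneg (Real.sqrt_nonneg 2)]
    exact mul_le_of_le_one_right (Real.sqrt_nonneg 2) (hr _))
  rw [Real.sq_sqrt (by norm_num), div_self (by norm_num)] at h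
  rw [← IsGaussian.map_rotation_eq_self (μ := stdGaussian E) (by simp) (Real.pi / 4),
    lintegral_map (by fun_prop) (by fun_prop)] at h
  refine le_trans (le_of_eq ?_) h
  refine lintegral_congr fun p => ?_
  congr 2
  simp only [hu, ContinuousLinearMap.rotation_apply, Real.cos_pi_div_four, Real.sin_pi_div_four]
  have h2 : -(√2 / 2) • p.1 + (√2 / 2) • p.2 = (-(√2 / 2)) • (p.1 - p.2) := by module
  rw [smul_add, smul_smul, smul_smul, hs, one_smul, one_smul, h2, real_inner_smul_left,
    real_inner_smul_right]
  linear_combination (-⟪v (p.1 + p.2), p.1 - p.2⟫) * hs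

/-- Exponential moments of a function `f x = ⟪v x, x⟫ = sup ⟪v, x⟫`, a support function with
selection `v`, are controlled by its Gaussian mean. -/
lemma lintegral_exp_half_support_le {f : E → ℝ} {v : E → E} (hv : Measurable v)
    (hf : Integrable f (stdGaussian E)) (hfm : Measurable f) (hf0 : ∀ x, 0 ≤ f x)
    (hv1 : ∀ x, ‖v x‖ ≤ 1) (hfv : ∀ x, f x = ⟪v x, x⟫) (hle : ∀ x y, ⟪v x, y⟫ ≤ f y) :
    ∫⁻ x, ENNReal.ofReal (Real.exp (f x / 2)) ∂(stdGaussian E)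
      ≤ ENNReal.ofReal (Real.exp (1 + ∫ x, f x ∂(stdGaussian E))) := by
  set μ := stdGaussian E with hμ
  set w := ∫ x, f x ∂μ with hw
  have h1 := lintegral_exp_inner_prod_stdGaussian (v := fun x => - v x) (by fun_prop) (r := 1)
    (fun x => by simpa using hv1 x)
  have h2 := lintegral_exp_inner_rotated_stdGaussian hv hv1
  -- Decoupling: for independent X and Y the product is E exp(f(X)/2 - f(Y)), and the exponent is
  -- dominated by conditionally Gaussian terms free of f.
  have hprod : (∫⁻ x, ENNReal.ofReal (Real.exp (f x / 2)) ∂μ) *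
      (∫⁻ y, ENNReal.ofReal (Real.exp (-f y)) ∂μ) ≤ ENNReal.ofReal (Real.exp 1) := by
    rw [← lintegral_prod_mul (by fun_prop) (by fun_prop)]
    calc _ ≤ ∫⁻ p, (ENNReal.ofReal (1 / 2) * ENNReal.ofReal (Real.exp ⟪v (p.1 + p.2), p.1 - p.2⟫)
            + ENNReal.ofReal (1 / 2) * ENNReal.ofReal (Real.exp ⟪- v p.1, p.2⟫)) ∂(μ.prod μ) := by
          refine lintegral_mono fun p => ?_
          simp only []
          rw [← ENNReal.ofReal_mul (Real.exp_pos _).le, ← ENNReal.ofReal_mul (by norm_num),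
            ← ENNReal.ofReal_mul (by norm_num),
            ← ENNReal.ofReal_add (by positivity) (by positivity), ← Real.exp_add]
          refine ENNReal.ofReal_le_ofReal ?_
          set a := ⟪v (p.1 + p.2), p.1 - p.2⟫ with ha
          set c := ⟪- v p.1, p.2⟫ with hc
          -- For coordinates X, Y: using v(X) as a test vector at X + Y gives f(X) ≤ f(X + Y) + c,
          -- while v(X + Y) splits as f(X + Y) = ⟨v(X + Y), X - Y⟩ + 2⟨v(X + Y), Y⟩ ≤ a + 2 f(Y).
          have e1 : f p.1 ≤ f (p.1 + p.2) + c := by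
            have := hle p.1 (p.1 + p.2)
            rw [inner_add_right, ← hfv] at this
            rw [hc, inner_neg_left]; linarith
          have e2 : f (p.1 + p.2) ≤ 2 * f p.2 + a := by
            have := hle (p.1 + p.2) p.2
            have e3 := hfv (p.1 + p.2)
            rw [inner_add_right] at e3
            rw [ha, inner_sub_right]; linarith
          have e4 : f p.1 / 2 + -f p.2 ≤ (a + c) / 2 := by linarith
          have e5 := Real.add_one_le_exp ((a + c) / 2)
          have e6 : Real.exp ((a + c) / 2) ≤ 1 / 2 * Real.exp a + 1 / 2 * Real.exp c := by
            have ea : Real.exp a = Real.exp (a / 2) ^ 2 := by rw [← Real.exp_nat_mul]; ring_nf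
            have ec : Real.exp c = Real.exp (c / 2) ^ 2 := by rw [← Real.exp_nat_mul]; ring_nf
            rw [ea, ec, show (a + c) / 2 = a / 2 + c / 2 by ring, Real.exp_add]
            nlinarith [sq_nonneg (Real.exp (a / 2) - Real.exp (c / 2))]
          exact (Real.exp_le_exp.2 e4).trans e6
      _ = ENNReal.ofReal (1 / 2) * (∫⁻ p, ENNReal.ofReal
              (Real.exp ⟪v (p.1 + p.2), p.1 - p.2⟫) ∂(μ.prod μ))
            + ENNReal.ofReal (1 / 2) *
              (∫⁻ p, ENNReal.ofReal (Real.exp ⟪- v p.1, p.2⟫) ∂(μ.prod μ)) := by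
          rw [lintegral_add_left (by fun_prop), lintegral_const_mul _ (by fun_prop),
            lintegral_const_mul _ (by fun_prop)]
      _ ≤ ENNReal.ofReal (1 / 2) * ENNReal.ofReal (Real.exp 1)
            + ENNReal.ofReal (1 / 2) * ENNReal.ofReal (Real.exp 1) := by
          gcongr
          refine h1.trans (ENNReal.ofReal_le_ofReal (Real.exp_le_exp.2 (by norm_num)))
      _ = ENNReal.ofReal (Real.exp 1) := by
          rw [← add_mul, ← ENNReal.ofReal_add (by norm_num) (by norm_num)]
          norm_num
  -- Jensen's inequality through the tangent line of exp at -w; it turns the factor E exp(-f) into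
  -- exp(-w).
  have hjensen : ENNReal.ofReal (Real.exp (-w)) ≤ ∫⁻ y, ENNReal.ofReal (Real.exp (-f y)) ∂μ := by
    have hint : Integrable (fun y => Real.exp (-f y)) μ := by
      refine Integrable.of_bound (by fun_prop) 1 (ae_of_all _ fun y => ?_)
      rw [Real.norm_eq_abs, Real.abs_exp]
      exact Real.exp_le_one_iff.2 (by linarith [hf0 y])
    rw [← ofReal_integral_eq_lintegral_ofReal hint (ae_of_all _ fun _ => (Real.exp_pos _).le)]
    refine ENNReal.ofReal_le_ofReal ?_
    have hsub : Integrable (fun y => w - f y) μ := (integrable_const _).sub hf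
    have hlin : Integrable (fun y => Real.exp (-w) * (1 + (w - f y))) μ :=
      ((integrable_const _).add hsub).const_mul _
    calc Real.exp (-w) = ∫ y, Real.exp (-w) * (1 + (w - f y)) ∂μ := by
          rw [integral_const_mul, integral_add (integrable_const _) hsub,
            integral_sub (integrable_const _) hf]
          simp [hw]
      _ ≤ _ := by
          refine integral_mono hlin hint fun y => ?_
          have := Real.add_one_le_exp (w - f y)
          calc Real.exp (-w) * (1 + (w - f y)) ≤ Real.exp (-w) * Real.exp (w - f y) := by
                gcongr; linarith
            _ = Real.exp (-f y) := by rw [← Real.exp_add]; ring_nf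
  calc ∫⁻ x, ENNReal.ofReal (Real.exp (f x / 2)) ∂μ
      = (∫⁻ x, ENNReal.ofReal (Real.exp (f x / 2)) ∂μ) * ENNReal.ofReal (Real.exp (-w))
          * ENNReal.ofReal (Real.exp w) := by
        rw [mul_assoc, ← ENNReal.ofReal_mul (Real.exp_pos _).le, ← Real.exp_add]; simp
    _ ≤ ENNReal.ofReal (Real.exp 1) * ENNReal.ofReal (Real.exp w) := by
        gcongr
        exact (mul_le_mul_right hjensen _).trans hprod
    _ = _ := by rw [← ENNReal.ofReal_mul (Real.exp_pos _).le, ← Real.exp_add]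

/-- Markov's inequality for exp(f/2) at level exp(2w): exp(-2w) · exp(1 + w) = exp(1 - w). Any upper
bound w of the mean will do. -/
lemma measure_gt_support_le {f : E → ℝ} {v : E → E} (hv : Measurable v)
    (hf : Integrable f (stdGaussian E)) (hfm : Measurable f) (hf0 : ∀ x, 0 ≤ f x)
    (hv1 : ∀ x, ‖v x‖ ≤ 1) (hfv : ∀ x, f x = ⟪v x, x⟫) (hle : ∀ x y, ⟪v x, y⟫ ≤ f y)
    {w : ℝ} (hw : ∫ x, f x ∂(stdGaussian E) ≤ w) :
    stdGaussian E {x | 4 * w < f x} ≤ ENNReal.ofReal (Real.exp (1 - w)) := by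
  have h := lintegral_exp_half_support_le hv hf hfm hf0 hv1 hfv hle
  have hm := mul_meas_ge_le_lintegral (μ := stdGaussian E)
    (f := fun x => ENNReal.ofReal (Real.exp (f x / 2))) (by fun_prop)
    (ENNReal.ofReal (Real.exp (2 * w)))
  have hsub : {x | 4 * w < f x} ⊆ {x | ENNReal.ofReal (Real.exp (2 * w))
      ≤ ENNReal.ofReal (Real.exp (f x / 2))} := fun x hx => by
    have hx : 4 * w < f x := hx
    exact ENNReal.ofReal_le_ofReal (Real.exp_le_exp.2 (by linarith))
  calc stdGaussian E {x | 4 * w < f x}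
      ≤ ENNReal.ofReal (Real.exp (-(2 * w))) * (ENNReal.ofReal (Real.exp (2 * w)) *
          stdGaussian E {x | 4 * w < f x}) := by
        rw [← mul_assoc, ← ENNReal.ofReal_mul (Real.exp_pos _).le, ← Real.exp_add]; simp
    _ ≤ ENNReal.ofReal (Real.exp (-(2 * w))) * ENNReal.ofReal (Real.exp (1 + w)) := by
        gcongr
        calc _ ≤ _ := mul_le_mul_right (measure_mono hsub) _
          _ ≤ _ := hm
          _ ≤ _ := h
          _ ≤ _ := ENNReal.ofReal_le_ofReal (Real.exp_le_exp.2 (by linarith))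
    _ = _ := by rw [← ENNReal.ofReal_mul (Real.exp_pos _).le, ← Real.exp_add]; ring_nf

/-- Choose the least index attaining the finite maximum, which makes the selection measurable, and
flip the sign so that the inner product becomes its absolute value. -/
lemma exists_measurable_support_selection (u : ℕ → E) (hu : ∀ k, ‖u k‖ ≤ 1) (n : ℕ) :
    ∃ v : E → E, Measurable v ∧ (∀ x, ‖v x‖ ≤ 1) ∧
      (∀ x, ∃ k ≤ n, ⟪v x, x⟫ = |⟪u k, x⟫|) ∧ (∀ x, ∀ k ≤ n, |⟪u k, x⟫| ≤ ⟪v x, x⟫) ∧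
      ∀ x, ∃ k ≤ n, ∀ y, ⟪v x, y⟫ ≤ |⟪u k, y⟫| := by
  classical
  have hp : ∀ x : E, ∃ j, j ≤ n ∧ ∀ k ≤ n, |⟪u k, x⟫| ≤ |⟪u j, x⟫| := fun x => by
    obtain ⟨j, hj, hmax⟩ := Finset.exists_max_image (Finset.range (n + 1)) (fun k => |⟪u k, x⟫|)
      ⟨0, by simp⟩
    exact ⟨j, by simpa [Nat.lt_succ_iff] using hj, fun k hk => hmax k (by simp; omega)⟩
  have hmeas : Measurable fun x => Nat.find (hp x) := by
    refine measurable_find hp fun j => ?_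
    have : {x : E | j ≤ n ∧ ∀ k ≤ n, |⟪u k, x⟫| ≤ |⟪u j, x⟫|} =
        {x | j ≤ n} ∩ ⋂ k, ⋂ (_ : k ≤ n), {x | |⟪u k, x⟫| ≤ |⟪u j, x⟫|} := by
      ext x; simp
    rw [this]
    refine (MeasurableSet.const _).inter (MeasurableSet.iInter fun k => MeasurableSet.iInter
      fun _ => measurableSet_le (by fun_prop) (by fun_prop))
  set s : E → E := fun x => u (Nat.find (hp x)) with hs
  have hsm : Measurable s := (measurable_from_nat (f := u)).comp hmeas
  refine ⟨fun x => if 0 ≤ ⟪s x, x⟫ then s x else - s x, ?_, ?_, ?_, ?_, ?_⟩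
  · exact Measurable.ite (measurableSet_le measurable_const (by fun_prop)) hsm hsm.neg
  · intro x
    simp only []
    split_ifs <;> simp [hs, hu]
  · intro x
    refine ⟨_, (Nat.find_spec (hp x)).1, ?_⟩
    simp only []
    split_ifs with h
    · rw [abs_of_nonneg h]
    · rw [abs_of_neg (not_le.1 h), inner_neg_left]
  · intro x k hk
    refine ((Nat.find_spec (hp x)).2 k hk).trans (le_of_eq ?_)
    simp only []
    split_ifs with h
    · rw [abs_of_nonneg h]
    · rw [abs_of_neg (not_le.1 h), inner_neg_left]
  · intro x
    refine ⟨_, (Nat.find_spec (hp x)).1, fun y => ?_⟩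
    simp only []
    split_ifs
    · exact le_abs_self _
    · rw [inner_neg_left]; exact neg_le_abs _

/-- Concentration of the supremum of a countable Gaussian process with variances at most `1`
whose supremum is dominated by a function `q` of mean at most `w`. -/
lemma measure_exists_gt_le {u : ℕ → E} (hu : ∀ k, ‖u k‖ ≤ 1) {q : E → ℝ}
    (hq : Integrable q (stdGaussian E)) (hqu : ∀ k x, |⟪u k, x⟫| ≤ q x) {w : ℝ}
    (hw : ∫ x, q x ∂(stdGaussian E) ≤ w) :
    stdGaussian E {x | ∃ k, 4 * w < |⟪u k, x⟫|} ≤ ENNReal.ofReal (Real.exp (1 - w)) := by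
  -- The finite-index events increase to the whole event, and the bound for each of them does not
  -- depend on n.
  set s : ℕ → Set E := fun n => {x | ∃ k ≤ n, 4 * w < |⟪u k, x⟫|} with hs
  have hU : {x | ∃ k, 4 * w < |⟪u k, x⟫|} = ⋃ n, s n := by
    ext x
    simp only [hs, Set.mem_ofPred_eq, Set.mem_iUnion]
    exact ⟨fun ⟨k, h⟩ => ⟨k, k, le_rfl, h⟩, fun ⟨_, k, _, h⟩ => ⟨k, h⟩⟩
  have hmono : Monotone s := fun a b hab x ⟨k, hk, h⟩ => ⟨k, hk.trans hab, h⟩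
  rw [hU, hmono.measure_iUnion]
  refine iSup_le fun n => ?_
  obtain ⟨v, hvm, hv1, hve, hvmax, hvle⟩ := exists_measurable_support_selection u hu n
  have hfm : Measurable fun x => ⟪v x, x⟫ := by fun_prop
  have hf0 : ∀ x, 0 ≤ ⟪v x, x⟫ := fun x => (abs_nonneg _).trans (hvmax x 0 (Nat.zero_le _))
  have hfq : ∀ x, ⟪v x, x⟫ ≤ q x := fun x => by
    obtain ⟨k, _, h⟩ := hve x
    exact h ▸ hqu k x
  have hfi : Integrable (fun x => ⟪v x, x⟫) (stdGaussian E) :=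
    hq.mono' hfm.aestronglyMeasurable
      (ae_of_all _ fun x => by rw [Real.norm_eq_abs, abs_of_nonneg (hf0 x)]; exact hfq x)
  refine le_trans (measure_mono ?_) (measure_gt_support_le hvm hfi hfm hf0 hv1 (fun _ => rfl)
    (fun x y => ?_) ((integral_mono hfi hq hfq).trans hw))
  · rintro x ⟨k, hk, h⟩
    exact h.trans_le (hvmax x k hk)
  · obtain ⟨k, hk, h⟩ := hvle x
    exact (h y).trans (hvmax y k hk)

lemma integrable_iSup_abs_inner {S : Set E} (hS : ∀ v ∈ S, ‖v‖ ≤ 1) :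
    Integrable (fun g : E => ⨆ v : S, |⟪g, (v : E)⟫|) (stdGaussian E) := by
  refine (IsGaussian.integrable_id (μ := stdGaussian E)).norm.mono'
    (continuous_iSup_abs_inner hS).aestronglyMeasurable (ae_of_all _ fun g => ?_)
  rw [Real.norm_eq_abs, abs_of_nonneg (iSup_abs_inner_nonneg S g)]
  exact iSup_abs_inner_le_norm hS g

/-- Concentration for the Gaussian width of a damped Gaussian vector. -/
lemma measure_exists_dampedAlong_gt_le {x : E} (hx : ‖x‖ = 1) {ρ : ℝ} (h0 : 0 ≤ ρ) (h1 : ρ ≤ 1)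
    {S : Set E} (hS : ∀ v ∈ S, ‖v‖ ≤ 1) :
    stdGaussian E {g | ∃ v ∈ S, 4 * (∫ g, ⨆ v : S, |⟪g, (v : E)⟫| ∂(stdGaussian E))
        < |⟪dampedAlong x ρ g, v⟫|} ≤
      ENNReal.ofReal (Real.exp (1 - ∫ g, ⨆ v : S, |⟪g, (v : E)⟫| ∂(stdGaussian E))) := by
  set w := ∫ g, ⨆ v : S, |⟪g, (v : E)⟫| ∂(stdGaussian E) with hw
  rcases S.eq_empty_or_nonempty with rfl | hne
  · simp
  have : Nonempty S := hne.to_subtype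
  -- With R the reflection in the hyperplane orthogonal to x, damping is the convex combination
  -- (1+ρ)/2 · id + (1-ρ)/2 · R. Since R preserves the Gaussian law, the damped supremum is
  -- dominated by a function of mean exactly w.
  set R : E ≃ₗᵢ[ℝ] E := (ℝ ∙ x)ᗮ.reflection with hR
  have hRapp : ∀ g, R g = g - (2 * ⟪x, g⟫) • x := fun g => by
    rw [hR, Submodule.reflection_orthogonal_apply, Submodule.reflection_singleton_apply]
    rw [hx]
    simp only [RCLike.ofReal_real_eq_id, id, one_pow, div_one]
    module
  set q : E → ℝ := fun g => ⨆ v : S, |⟪g, (v : E)⟫| with hq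
  have hqi : Integrable q (stdGaussian E) := integrable_iSup_abs_inner hS
  have hRmap : (stdGaussian E).map R = stdGaussian E := stdGaussian_map R
  have hmp : MeasurePreserving R (stdGaussian E) (stdGaussian E) := ⟨R.continuous.measurable, hRmap⟩
  have hqRi : Integrable (fun g => q (R g)) (stdGaussian E) := hmp.integrable_comp_of_integrable hqi
  have hqR : ∫ g, q (R g) ∂(stdGaussian E) = w :=
    hmp.integral_comp R.toHomeomorph.measurableEmbedding q
  have key : stdGaussian E {g | ∃ k, 4 * w <
      |⟪dampedAlong x ρ (TopologicalSpace.denseSeq S k : E), g⟫|} ≤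
      ENNReal.ofReal (Real.exp (1 - w)) := by
    refine measure_exists_gt_le (q := fun g => (1 + ρ) / 2 * q g + (1 - ρ) / 2 * q (R g))
      (fun k => (norm_dampedAlong_le hx h0 h1 _).trans (hS _ (Subtype.prop _)))
      ((hqi.const_mul _).add (hqRi.const_mul _)) (fun k g => ?_) (le_of_eq ?_)
    · rw [← inner_dampedAlong]
      have hT : dampedAlong x ρ g = ((1 + ρ) / 2) • g + ((1 - ρ) / 2) • R g := by
        rw [hRapp, dampedAlong]; module
      rw [hT]
      refine (abs_inner_le_iSup hS _ _).trans ((iSup_abs_inner_add_le hS _ _).trans ?_)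
      rw [iSup_abs_inner_smul S (by linarith), iSup_abs_inner_smul S (by linarith)]
    · rw [integral_add (hqi.const_mul _) (hqRi.const_mul _), integral_const_mul,
        integral_const_mul, hqR, ← hw]
      ring
  refine (measure_mono ?_).trans key
  rintro g ⟨v, hv, hlt⟩
  -- The strict inequality is an open condition on v, so a dense sequence in S already witnesses the
  -- event.
  have hopen : IsOpen {z : S | 4 * w < |⟪dampedAlong x ρ g, (z : E)⟫|} :=
    isOpen_lt continuous_const (by fun_prop)
  obtain ⟨_, hk, k, rfl⟩ := (TopologicalSpace.denseRange_denseSeq S).inter_open_nonempty _ hopen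
    ⟨⟨v, hv⟩, hlt⟩
  exact ⟨k, by rw [← inner_dampedAlong]; exact hk⟩

end GaussianConcentration

/-! ### Elementary properties of the quantizer -/

section Quantizer

variable {b : ℕ} (Q : Quantizer b)

lemma measurableSet_bin (k : Fin (2 ^ (b - 1))) : MeasurableSet (Q.bin k) :=
  (measurableSet_le measurable_const measurable_coe_real_ereal).inter
    (measurableSet_lt measurable_coe_real_ereal measurable_const)

lemma measurable_real_sign : Measurable Real.sign := by
  unfold Real.sign
  exact Measurable.ite measurableSet_Iio measurable_const
    (Measurable.ite measurableSet_Ioi measurable_const measurable_const)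

lemma measurable_quantize : Measurable Q.quantize := by
  refine measurable_real_sign.mul (Finset.measurable_sum _ fun k _ => ?_)
  exact (measurable_const.indicator (measurableSet_bin Q k)).comp measurable_norm

lemma quantize_level_nonneg (r : ℝ) :
    0 ≤ ∑ k, (Q.bin k).indicator (fun _ => Q.μ k) r :=
  Finset.sum_nonneg fun k _ => Set.indicator_nonneg (fun _ _ => (Q.μ_pos k).le) _

lemma quantize_mul_self_nonneg (z : ℝ) : 0 ≤ Q.quantize z * z := by
  have : Q.quantize z * z = (z.sign * z) * ∑ k, (Q.bin k).indicator (fun _ => Q.μ k) |z| := by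
    rw [Quantizer.quantize]; ring
  rw [this, mul_comm z.sign]
  refine mul_nonneg ?_ (quantize_level_nonneg Q _)
  rcases lt_trichotomy z 0 with h | rfl | h
  · rw [Real.sign_of_neg h]; linarith
  · simp
  · rw [Real.sign_of_pos h]; linarith

lemma abs_quantize_le (z : ℝ) : |Q.quantize z| ≤ ∑ k, Q.μ k := by
  rw [Quantizer.quantize, abs_mul, abs_of_nonneg (quantize_level_nonneg Q _)]
  have h1 : |z.sign| ≤ 1 := by
    rcases Real.sign_apply_eq z with h | h | h <;> simp [h]
  refine (mul_le_of_le_one_left (quantize_level_nonneg Q _) h1).trans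
    (Finset.sum_le_sum fun k _ => ?_)
  exact Set.indicator_le_self' (fun _ _ => (Q.μ_pos k).le) _

/-- A nonnegative r missing every bin would, by induction, lie above every threshold, including the
last one, ⊤. -/
lemma exists_mem_bin {r : ℝ} (hr : 0 ≤ r) : ∃ k, r ∈ Q.bin k := by
  by_contra! h
  have : ∀ j, Q.t j ≤ (r : EReal) := fun j => by
    induction j using Fin.induction with
    | zero => rw [Q.t_zero]; exact_mod_cast hr
    | succ i ih =>
      by_contra hlt
      exact h i ⟨ih, not_le.1 hlt⟩
  have h2 := this (Fin.last _)
  rw [Q.t_last, top_le_iff] at h2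
  exact EReal.coe_ne_top r h2

lemma quantize_ne_zero {z : ℝ} (hz : z ≠ 0) : Q.quantize z ≠ 0 := by
  obtain ⟨k, hk⟩ := exists_mem_bin Q (abs_nonneg z)
  refine mul_ne_zero (by simpa [Real.sign_eq_zero_iff] using hz) (ne_of_gt ?_)
  refine Finset.sum_pos' (fun k _ => Set.indicator_nonneg (fun _ _ => (Q.μ_pos k).le) _)
    ⟨k, Finset.mem_univ _, ?_⟩
  rw [Set.indicator_of_mem hk]
  exact Q.μ_pos k

end Quantizer

/-! ### Chernoff bound and scalar exponential inequalities -/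

/-- The Chernoff bound for a sum of independent copies of `h`. -/
lemma measure_pi_sum_nonneg_le {X : Type*} [MeasurableSpace X] {ν : Measure X}
    [IsProbabilityMeasure ν] {h : X → ℝ}
    (hi : Integrable (fun x => Real.exp (h x)) ν) {r : ℝ}
    (hr : ∫ x, Real.exp (h x) ∂ν ≤ Real.exp (-r)) (m : ℕ) :
    (Measure.pi fun _ : Fin m => ν).real {x : Fin m → X | 0 ≤ ∑ i, h (x i)} ≤ Real.exp (-(r * m)) := by
  have hprod : (fun x : Fin m → X => Real.exp (∑ i, h (x i))) =
      fun x : Fin m → X => ∏ i, Real.exp (h (x i)) := by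
    ext x; rw [Real.exp_sum]
  have hint : Integrable (fun x : Fin m → X => Real.exp (∑ i, h (x i)))
      (Measure.pi fun _ : Fin m => ν) := by
    rw [hprod]
    exact Integrable.fintype_prod (f := fun _ x => Real.exp (h x)) fun _ => hi
  have hmk := mul_meas_ge_le_integral_of_nonneg
    (ae_of_all _ fun x : Fin m → X => (Real.exp_pos (∑ i, h (x i))).le) hint 1
  rw [one_mul] at hmk
  have hsub : {x : Fin m → X | 0 ≤ ∑ i, h (x i)} =
      {x : Fin m → X | 1 ≤ Real.exp (∑ i, h (x i))} := by
    ext x; exact Real.one_le_exp_iff.symm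
  rw [hsub]
  refine hmk.trans ?_
  rw [hprod, integral_fintype_prod_eq_prod (f := fun _ x => Real.exp (h x))]
  simp only [Finset.prod_const, Finset.card_univ, Fintype.card_fin]
  calc _ ≤ Real.exp (-r) ^ m := 
          pow_le_pow_left₀ (integral_nonneg fun _ => (Real.exp_pos _).le) hr m
    _ = _ := by rw [← Real.exp_nat_mul]; ring_nf


/-- The linear term keeps coefficient 1 and the remainder is quadratic in a, with only exp x
required to be integrable: x² exp(a x) ≤ 8 exp x when a ≤ 1/2. -/
lemma exp_mul_le_of_nonneg {a x : ℝ} (ha : 0 ≤ a) (ha2 : a ≤ 1 / 2) (hx : 0 ≤ x) :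
    Real.exp (a * x) ≤ 1 + a * x + 8 * a ^ 2 * Real.exp x := by
  set u := a * x with hu
  have hu0 : 0 ≤ u := mul_nonneg ha hx
  have h1 : Real.exp u - 1 ≤ u * Real.exp u := by
    have h := Real.add_one_le_exp (-u)
    have h2 : Real.exp (-u) * Real.exp u = 1 := by rw [← Real.exp_add]; simp
    nlinarith [Real.exp_pos u]
  have h2 : Real.exp u ≤ 1 + u + u ^ 2 * Real.exp u := by nlinarith
  have h3 : x ^ 2 ≤ 8 * Real.exp (x / 2) := by
    have := Real.quadratic_le_exp_of_nonneg (show 0 ≤ x / 2 by linarith)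
    nlinarith
  have h4 : Real.exp u ≤ Real.exp (x / 2) := Real.exp_le_exp.2 (by nlinarith)
  have h5 : Real.exp x = Real.exp (x / 2) * Real.exp (x / 2) := by
    rw [← Real.exp_add]; ring_nf
  have h6 : u ^ 2 * Real.exp u ≤ 8 * a ^ 2 * Real.exp x := by
    calc u ^ 2 * Real.exp u = a ^ 2 * (x ^ 2 * Real.exp u) := by rw [hu]; ring
      _ ≤ a ^ 2 * ((8 * Real.exp (x / 2)) * Real.exp (x / 2)) := by gcongr
      _ = _ := by rw [h5]; ring
  linarith

/-- From exp(-u) ≤ 1 / (1 + u) and (1 + u)(1 - u + u²) = 1 + u³ ≥ 1. -/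
lemma exp_neg_le_of_nonneg {u : ℝ} (hu : 0 ≤ u) : Real.exp (-u) ≤ 1 - u + u ^ 2 := by
  have h1 := Real.add_one_le_exp u
  have h2 : Real.exp (-u) * Real.exp u = 1 := by rw [← Real.exp_add]; simp
  have h3 : Real.exp (-u) * (1 + u) ≤ 1 := by nlinarith [Real.exp_pos (-u)]
  nlinarith [Real.exp_pos (-u), pow_nonneg hu 3]

lemma pow_four_le_exp (x : ℝ) : x ^ 4 ≤ 24 * (Real.exp x + Real.exp (-x)) := by
  have key : ∀ y : ℝ, 0 ≤ y → y ^ 4 ≤ 24 * Real.exp y := fun y hy => by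
    have := Real.pow_div_factorial_le_exp y hy 4
    norm_num [Nat.factorial] at this
    linarith
  rcases le_total 0 x with h | h
  · linarith [key x h, Real.exp_pos (-x)]
  · have := key (-x) (by linarith)
    rw [show (-x) ^ 4 = x ^ 4 by ring] at this
    linarith [Real.exp_pos x]

/-! ### Moments and small-ball estimate for the standard normal law -/

section StdNormal

lemma integral_exp_stdNormal (t : ℝ) : ∫ x, Real.exp (t * x) ∂stdNormal = Real.exp (t ^ 2 / 2) := by
  have h := congrFun (mgf_id_gaussianReal (μ := 0) (v := 1)) t
  simpa [mgf] using h

lemma integrable_pow_stdNormal (k : ℕ) : Integrable (fun x : ℝ => x ^ k) stdNormal := by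
  have h := memLp_id_gaussianReal (μ := 0) (v := 1) k
  have h2 := h.integrable_norm_pow'
  refine Integrable.mono h2 (by fun_prop) (ae_of_all _ fun x => by simp)

lemma integral_pow_four_stdNormal_le : ∫ x, x ^ 4 ∂stdNormal ≤ 96 := by
  have h1 := integrable_exp_mul_gaussianReal (μ := 0) (v := 1) 1
  have h2 := integrable_exp_mul_gaussianReal (μ := 0) (v := 1) (-1)
  calc ∫ x, x ^ 4 ∂stdNormal
      ≤ ∫ x, 24 * (Real.exp (1 * x) + Real.exp (-1 * x)) ∂stdNormal := by
        refine integral_mono (integrable_pow_stdNormal 4) ((h1.add h2).const_mul _) fun x => ?_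
        simpa using pow_four_le_exp x
    _ = 48 * Real.exp (1 / 2) := by
        rw [integral_const_mul, integral_add h1 h2, integral_exp_stdNormal, integral_exp_stdNormal]
        norm_num; ring
    _ ≤ 96 := by
        have h3 : Real.exp (1 / 2) * Real.exp (1 / 2) = Real.exp 1 := by
          rw [← Real.exp_add]; norm_num
        nlinarith [Real.exp_one_lt_d9, Real.exp_pos (1 / 2)]

lemma stdNormal_real_abs_lt_le {η : ℝ} (hη : 0 ≤ η) : stdNormal.real {x | |x| < η} ≤ 2 * η := by
  have hpdf : ∀ x, gaussianPDF 0 1 x ≤ 1 := fun x => by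
    rw [gaussianPDF, gaussianPDFReal]
    refine ENNReal.ofReal_le_one.2 ?_
    have h1 : (√(2 * Real.pi * (1 : NNReal)))⁻¹ ≤ 1 := by
      refine inv_le_one_of_one_le₀ (Real.one_le_sqrt.2 ?_)
      have := Real.pi_gt_three
      simp; linarith
    have h2 : Real.exp (-(x - 0) ^ 2 / (2 * (1 : NNReal))) ≤ 1 :=
      Real.exp_le_one_iff.2 (by
        rw [neg_div]; exact neg_nonpos.2 (by positivity))
    exact mul_le_one₀ h1 (Real.exp_pos _).le h2
  have hset : {x : ℝ | |x| < η} = Set.Ioo (-η) η := by ext; simp [abs_lt]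
  refine ENNReal.toReal_le_of_le_ofReal (by linarith) ?_
  rw [hset, stdNormal, gaussianReal_apply _ one_ne_zero]
  calc _ ≤ ∫⁻ _ in Set.Ioo (-η) η, 1 := lintegral_mono fun x => hpdf x
    _ = _ := by rw [setLIntegral_one, Real.volume_Ioo]; ring_nf

end StdNormal

/-! ### Moments and tail bounds of a normalized response -/

/-- A bounded odd-like response `p` to a standard normal input, normalized to have unit second
moment, together with a bound `L ≥ 1` controlling its sub-Gaussian norm. -/
structure NormalizedResponse (p : ℝ → ℝ) (L : ℝ) : Prop where
  measurable : Measurable p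
  bounded : ∃ B, ∀ x, |p x| ≤ B
  one_le : 1 ≤ L
  integral_sq : ∫ x, p x ^ 2 ∂stdNormal = 1
  integral_exp : ∫ x, Real.exp (p x ^ 2 / (2 * L) ^ 2) ∂stdNormal ≤ 2
  nonneg : ∀ x, 0 ≤ p x * x

namespace NormalizedResponse

variable {p : ℝ → ℝ} {L : ℝ}

lemma integrable_pow (h : NormalizedResponse p L) (k : ℕ) : Integrable (fun x => p x ^ k) stdNormal := by
  obtain ⟨B, hB⟩ := h.bounded
  refine Integrable.of_bound (h.measurable.pow_const k).aestronglyMeasurable (B ^ k)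
    (ae_of_all _ fun x => ?_)
  rw [norm_pow]
  exact pow_le_pow_left₀ (norm_nonneg _) (hB x) k

lemma integrable_exp (h : NormalizedResponse p L) : Integrable (fun x => Real.exp (p x ^ 2 / (2 * L) ^ 2)) stdNormal := by
  obtain ⟨B, hB⟩ := h.bounded
  have hm := h.measurable
  refine Integrable.of_bound (by fun_prop) (Real.exp (B ^ 2 / (2 * L) ^ 2))
    (ae_of_all _ fun x => ?_)
  rw [Real.norm_eq_abs, Real.abs_exp]
  refine Real.exp_le_exp.2 (div_le_div_of_nonneg_right ?_ (sq_nonneg _))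
  exact sq_le_sq' (abs_le.1 (hB x)).1 (abs_le.1 (hB x)).2

lemma integral_pow_four_le (h : NormalizedResponse p L) :
    ∫ x, p x ^ 4 ∂stdNormal ≤ 32 * L ^ 4 := by
  have hL := h.one_le
  calc ∫ x, p x ^ 4 ∂stdNormal
      ≤ ∫ x, 32 * L ^ 4 * (Real.exp (p x ^ 2 / (2 * L) ^ 2) - 1) ∂stdNormal := by
        refine integral_mono (h.integrable_pow 4)
          ((h.integrable_exp.sub (integrable_const _)).const_mul _) fun x => ?_
        set y := p x ^ 2 / (2 * L) ^ 2 with hy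
        have hy0 : 0 ≤ y := by positivity
        have h1 := Real.quadratic_le_exp_of_nonneg hy0
        have h2 : p x ^ 4 = 16 * L ^ 4 * y ^ 2 := by
          rw [hy]; field_simp; ring
        show p x ^ 4 ≤ 32 * L ^ 4 * (Real.exp y - 1)
        rw [h2]
        have : y ^ 2 ≤ 2 * (Real.exp y - 1) := by linarith
        nlinarith [mul_le_mul_of_nonneg_left this (show 0 ≤ 16 * L ^ 4 by positivity)]
    _ = 32 * L ^ 4 * (∫ x, Real.exp (p x ^ 2 / (2 * L) ^ 2) ∂stdNormal - 1) := by
        rw [integral_const_mul, integral_sub h.integrable_exp (integrable_const _)]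
        simp
    _ ≤ 32 * L ^ 4 * 1 := by
        gcongr
        linarith [h.integral_exp]
    _ = _ := mul_one _

lemma integrable_mul_self (h : NormalizedResponse p L) : Integrable (fun x => p x * x) stdNormal := by
  obtain ⟨B, hB⟩ := h.bounded
  have := integrable_pow_stdNormal 1
  simp only [pow_one] at this
  exact this.bdd_mul h.measurable.aestronglyMeasurable (ae_of_all _ hB)

lemma integrable_mul_self_sq (h : NormalizedResponse p L) : Integrable (fun x => (p x * x) ^ 2) stdNormal := by
  obtain ⟨B, hB⟩ := h.bounded
  simp only [mul_pow]
  refine (integrable_pow_stdNormal 2).bdd_mul (c := B ^ 2)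
    (h.measurable.pow_const 2).aestronglyMeasurable
    (ae_of_all _ fun x => ?_)
  rw [norm_pow]
  exact pow_le_pow_left₀ (norm_nonneg _) (hB x) 2

lemma integral_mul_self_sq_le (h : NormalizedResponse p L) :
    ∫ x, (p x * x) ^ 2 ∂stdNormal ≤ 64 * L ^ 4 := by
  have hL := h.one_le
  have hL4 : 1 ≤ L ^ 4 := one_le_pow₀ hL
  calc ∫ x, (p x * x) ^ 2 ∂stdNormal ≤ ∫ x, (1 / 2) * (p x ^ 4 + x ^ 4) ∂stdNormal := by
        refine integral_mono h.integrable_mul_self_sq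
          (((h.integrable_pow 4).add (integrable_pow_stdNormal 4)).const_mul _) fun x => ?_
        show (p x * x) ^ 2 ≤ (1 / 2) * (p x ^ 4 + x ^ 4)
        nlinarith [sq_nonneg (p x ^ 2 - x ^ 2)]
    _ = (1 / 2) * (∫ x, p x ^ 4 ∂stdNormal + ∫ x, x ^ 4 ∂stdNormal) := by
        rw [integral_const_mul, integral_add (h.integrable_pow 4) (integrable_pow_stdNormal 4)]
    _ ≤ (1 / 2) * (32 * L ^ 4 + 96) := by
        gcongr
        exacts [h.integral_pow_four_le, integral_pow_four_stdNormal_le]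
    _ ≤ _ := by linarith

/-- The unit second moment cannot hide in the bad regions: {|p| > M} carries at most 1/4 by the
fourth moment, and {|p| ≤ M, |x| < η} at most 1/4 by the small-ball bound. Elsewhere p² ≤ (M/η) p x,
so E[p x] ≥ η / (2M) = 1 / (16 M³). -/
lemma le_integral_mul_self (h : NormalizedResponse p L) :
    1 / (27648 * L ^ 6) ≤ ∫ x, p x * x ∂stdNormal := by
  have hL := h.one_le
  have hL0 : 0 < L := by linarith
  -- These choices give 32 L⁴ / M² ≤ 1/4 and 2 η M² = 1/4.
  set M := 12 * L ^ 2 with hM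
  set η := 1 / (8 * M ^ 2) with hη
  have hM0 : 0 < M := by positivity
  have hη0 : 0 < η := by positivity
  set W := ∫ x, p x * x ∂stdNormal with hW
  have hind : Integrable ({x : ℝ | |x| < η}.indicator fun _ => M ^ 2) stdNormal :=
    (integrable_const _).indicator (measurableSet_lt (by fun_prop) measurable_const)
  have key : ∀ x, p x ^ 2 ≤ M / η * (p x * x) + (1 / M ^ 2 * p x ^ 4
      + {x : ℝ | |x| < η}.indicator (fun _ => M ^ 2) x) := fun x => by
    have n1 : 0 ≤ M / η * (p x * x) := mul_nonneg (by positivity) (h.nonneg x)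
    have n2 : 0 ≤ 1 / M ^ 2 * p x ^ 4 := by positivity
    have n3 : 0 ≤ {x : ℝ | |x| < η}.indicator (fun _ => M ^ 2) x :=
      Set.indicator_nonneg (fun _ _ => sq_nonneg M) x
    by_cases h1 : M < |p x|
    · have : M ^ 2 ≤ p x ^ 2 := by rw [← sq_abs (p x)]; gcongr
      have : p x ^ 2 ≤ 1 / M ^ 2 * p x ^ 4 := by
        rw [one_div, inv_mul_eq_div, le_div_iff₀ (by positivity)]
        nlinarith [sq_nonneg (p x)]
      linarith
    · rw [not_lt] at h1
      by_cases h2 : |x| < η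
      · rw [Set.indicator_of_mem (by exact h2)]
        have : p x ^ 2 ≤ M ^ 2 := by rw [← sq_abs (p x)]; gcongr
        linarith
      · rw [not_lt] at h2
        have h3 : p x * x = |p x| * |x| := by rw [← abs_mul, abs_of_nonneg (h.nonneg x)]
        have : p x ^ 2 ≤ M / η * (p x * x) := by
          rw [h3, div_mul_eq_mul_div, le_div_iff₀ hη0, ← sq_abs (p x)]
          have e1 : |p x| * η ≤ |p x| * |x| := by gcongr
          have e2 : |p x| * (|p x| * η) ≤ M * (|p x| * |x|) :=
            mul_le_mul h1 e1 (by positivity) hM0.le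
          linarith
        linarith
  have hi1 : Integrable (fun x => M / η * (p x * x)) stdNormal :=
    h.integrable_mul_self.const_mul _
  have hi2 : Integrable (fun x => 1 / M ^ 2 * p x ^ 4) stdNormal :=
    (h.integrable_pow 4).const_mul _
  have hi3 : Integrable (fun x => 1 / M ^ 2 * p x ^ 4
      + {x : ℝ | |x| < η}.indicator (fun _ => M ^ 2) x) stdNormal := hi2.add hind
  have hint : 1 ≤ M / η * W + (1 / M ^ 2 * (∫ x, p x ^ 4 ∂stdNormal)
      + stdNormal.real {x | |x| < η} * M ^ 2) := by
    have := integral_mono (h.integrable_pow 2) (hi1.add hi3) key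
    rwa [h.integral_sq, integral_add' hi1 hi3, integral_const_mul, ← hW, integral_add hi2 hind,
      integral_const_mul, integral_indicator_const _ (measurableSet_lt (by fun_prop)
      measurable_const), smul_eq_mul] at this
  have h4 : 1 / M ^ 2 * (∫ x, p x ^ 4 ∂stdNormal) ≤ 1 / 4 := by
    calc _ ≤ 1 / M ^ 2 * (32 * L ^ 4) := by gcongr; exact h.integral_pow_four_le
      _ ≤ 1 / 4 := by
        rw [hM, one_div, inv_mul_eq_div, div_le_iff₀ (by positivity)]
        nlinarith [pow_pos hL0 4]
  have h5 : stdNormal.real {x | |x| < η} * M ^ 2 ≤ 1 / 4 := by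
    calc _ ≤ 2 * η * M ^ 2 := by gcongr; exact stdNormal_real_abs_lt_le hη0.le
      _ = 1 / 4 := by rw [hη]; field_simp; norm_num
  have h6 : 1 / 2 ≤ M / η * W := by linarith
  have h7 : M / η = 8 * M ^ 3 := by rw [hη]; field_simp
  rw [h7, hM] at h6
  rw [div_le_iff₀ (by positivity)]
  nlinarith

lemma integral_mul_self_pos (h : NormalizedResponse p L) :
    0 < ∫ x, p x * x ∂stdNormal :=
  lt_of_lt_of_le (by have := h.one_le; positivity) h.le_integral_mul_self

lemma measure_sum_sq_le (h : NormalizedResponse p L) (m : ℕ) :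
    (Measure.pi fun _ : Fin m => stdNormal).real {x | 9 / 4 * m ≤ ∑ i, p (x i) ^ 2}
      ≤ Real.exp (-(1 / (10 ^ 12 * L ^ 16) * m)) := by
  have hL := h.one_le
  have hL0 : 0 < L := by linarith
  set κ := 1 / (2 * L) ^ 2 with hκ
  have hκ0 : 0 < κ := by positivity
  have hκ1 : κ ≤ 1 / 4 := by
    rw [hκ, div_le_div_iff₀ (by positivity) (by norm_num)]
    nlinarith
  -- The Chernoff exponent is -(5/4) a κ + 16 a², equal to -(3/128) κ² for this a.
  set a := κ / 32 with ha
  have hpt : ∀ x, Real.exp (a * (p x ^ 2 / (2 * L) ^ 2)) ≤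
      1 + a * κ * p x ^ 2 + 8 * a ^ 2 * Real.exp (p x ^ 2 / (2 * L) ^ 2) := fun x => by
    refine (exp_mul_le_of_nonneg (by positivity) (by linarith) (by positivity)).trans
      (le_of_eq ?_)
    rw [hκ]; ring
  have hRint : Integrable (fun x => 1 + a * κ * p x ^ 2
      + 8 * a ^ 2 * Real.exp (p x ^ 2 / (2 * L) ^ 2)) stdNormal :=
    ((integrable_const _).add ((h.integrable_pow 2).const_mul _)).add
      (h.integrable_exp.const_mul _)
  have hm := h.measurable
  have hLint : Integrable (fun x => Real.exp (a * (p x ^ 2 / (2 * L) ^ 2))) stdNormal :=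
    hRint.mono' (by fun_prop) (ae_of_all _ fun x => by
      rw [Real.norm_eq_abs, Real.abs_exp]; exact hpt x)
  have hbound : ∫ x, Real.exp (a * (p x ^ 2 / (2 * L) ^ 2)) ∂stdNormal ≤
      1 + a * κ + 16 * a ^ 2 := by
    refine (integral_mono hLint hRint hpt).trans ?_
    have hi1 : Integrable (fun x => 1 + a * κ * p x ^ 2) stdNormal :=
      (integrable_const _).add ((h.integrable_pow 2).const_mul _)
    rw [integral_add hi1 (h.integrable_exp.const_mul _), integral_add (integrable_const _)
      ((h.integrable_pow 2).const_mul _), integral_const_mul, integral_const_mul, h.integral_sq]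
    simp only [integral_const, probReal_univ, smul_eq_mul, mul_one]
    nlinarith [h.integral_exp, sq_nonneg a]
  have hsplit : ∀ x, Real.exp (a * κ * (p x ^ 2 - 9 / 4)) =
      Real.exp (-(9 / 4 * (a * κ))) * Real.exp (a * (p x ^ 2 / (2 * L) ^ 2)) := fun x => by
    rw [← Real.exp_add, hκ]; congr 1; ring
  have hr : ∫ x, Real.exp (a * κ * (p x ^ 2 - 9 / 4)) ∂stdNormal ≤
      Real.exp (-(1 / (10 ^ 12 * L ^ 16))) := by
    simp_rw [hsplit]
    rw [integral_const_mul]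
    calc _ ≤ Real.exp (-(9 / 4 * (a * κ))) * Real.exp (a * κ + 16 * a ^ 2) := by
          gcongr
          refine hbound.trans ?_
          linarith [Real.add_one_le_exp (a * κ + 16 * a ^ 2)]
      _ = Real.exp (-(3 / 128 * κ ^ 2)) := by
          rw [← Real.exp_add, ha]; congr 1; ring
      _ ≤ _ := by
          refine Real.exp_le_exp.2 (neg_le_neg ?_)
          rw [hκ, div_le_iff₀ (by positivity)]
          have : 1 ≤ L ^ 12 := one_le_pow₀ hL
          field_simp
          nlinarith
  have hc := measure_pi_sum_nonneg_le (ν := stdNormal)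
    (h := fun x => a * κ * (p x ^ 2 - 9 / 4))
    (by simp_rw [hsplit]; exact hLint.const_mul _) hr m
  refine le_trans (measureReal_mono (fun x hx => ?_)) hc
  have hx : 9 / 4 * (m : ℝ) ≤ ∑ i, p (x i) ^ 2 := hx
  show 0 ≤ ∑ i, a * κ * (p (x i) ^ 2 - 9 / 4)
  rw [← Finset.mul_sum, Finset.sum_sub_distrib]
  refine mul_nonneg (by positivity) ?_
  simp
  linarith

/-- The summands are nonnegative, so their lower tail needs only a second-moment bound. -/
lemma measure_sum_mul_self_le (h : NormalizedResponse p L) (m : ℕ) :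
    (Measure.pi fun _ : Fin m => stdNormal).real
        {x | ∑ i, p (x i) * x i ≤ m * (∫ x, p x * x ∂stdNormal) / 2}
      ≤ Real.exp (-(1 / (10 ^ 12 * L ^ 16) * m)) := by
  have hL := h.one_le
  have hL0 : 0 < L := by linarith
  set W := ∫ x, p x * x ∂stdNormal with hW
  have hW0 : 0 < W := h.integral_mul_self_pos
  -- Minimizer of the exponent -a W / 2 + 64 L⁴ a², with value -W² / (1024 L⁴). Inserting W ≥ 1 /
  -- (27648 L⁶) gives the common rate 1 / (10¹² L¹⁶), since 27648² · 1024 < 10¹².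
  set a := W / (256 * L ^ 4) with ha
  have ha0 : 0 < a := by positivity
  have hm := h.measurable
  have hpt : ∀ x, Real.exp (-(a * (p x * x))) ≤ 1 - a * (p x * x) + a ^ 2 * (p x * x) ^ 2 :=
    fun x => (exp_neg_le_of_nonneg (mul_nonneg ha0.le (h.nonneg x))).trans (le_of_eq (by ring))
  have hRint : Integrable (fun x => 1 - a * (p x * x) + a ^ 2 * (p x * x) ^ 2) stdNormal :=
    ((integrable_const _).sub (h.integrable_mul_self.const_mul _)).add
      (h.integrable_mul_self_sq.const_mul _)
  have hLint : Integrable (fun x => Real.exp (-(a * (p x * x)))) stdNormal :=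
    hRint.mono' (by fun_prop) (ae_of_all _ fun x => by
      rw [Real.norm_eq_abs, Real.abs_exp]; exact hpt x)
  have hbound : ∫ x, Real.exp (-(a * (p x * x))) ∂stdNormal ≤
      1 - a * W + a ^ 2 * (64 * L ^ 4) := by
    refine (integral_mono hLint hRint hpt).trans ?_
    have hi1 : Integrable (fun x => 1 - a * (p x * x)) stdNormal :=
      (integrable_const _).sub (h.integrable_mul_self.const_mul _)
    rw [integral_add hi1 (h.integrable_mul_self_sq.const_mul _), integral_sub (integrable_const _)
      (h.integrable_mul_self.const_mul _), integral_const_mul, integral_const_mul, ← hW]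
    simp only [integral_const, probReal_univ, smul_eq_mul, mul_one]
    gcongr
    exact h.integral_mul_self_sq_le
  have hsplit : ∀ x, Real.exp (a * (W / 2 - p x * x)) =
      Real.exp (a * W / 2) * Real.exp (-(a * (p x * x))) := fun x => by
    rw [← Real.exp_add]; congr 1; ring
  have hr : ∫ x, Real.exp (a * (W / 2 - p x * x)) ∂stdNormal ≤
      Real.exp (-(1 / (10 ^ 12 * L ^ 16))) := by
    simp_rw [hsplit]
    rw [integral_const_mul]
    calc _ ≤ Real.exp (a * W / 2) * Real.exp (-(a * W) + a ^ 2 * (64 * L ^ 4)) := by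
          gcongr
          refine hbound.trans ?_
          linarith [Real.add_one_le_exp (-(a * W) + a ^ 2 * (64 * L ^ 4))]
      _ = Real.exp (-(W ^ 2 / (1024 * L ^ 4))) := by
          rw [← Real.exp_add, ha]; congr 1; field_simp; ring
      _ ≤ _ := by
          refine Real.exp_le_exp.2 (neg_le_neg ?_)
          have hsq : (1 / (27648 * L ^ 6)) ^ 2 ≤ W ^ 2 :=
            pow_le_pow_left₀ (by positivity) h.le_integral_mul_self 2
          calc 1 / (10 ^ 12 * L ^ 16) ≤ (1 / (27648 * L ^ 6)) ^ 2 / (1024 * L ^ 4) := by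
                rw [div_pow, div_div, one_pow]
                refine one_div_le_one_div_of_le (by positivity) ?_
                nlinarith [pow_pos hL0 16]
            _ ≤ _ := by gcongr
  have hc := measure_pi_sum_nonneg_le (ν := stdNormal)
    (h := fun x => a * (W / 2 - p x * x))
    (by simp_rw [hsplit]; exact hLint.const_mul _) hr m
  refine le_trans (measureReal_mono (fun x hx => ?_)) hc
  have hx : ∑ i, p (x i) * x i ≤ m * W / 2 := hx
  show 0 ≤ ∑ i, a * (W / 2 - p (x i) * x i)
  rw [← Finset.mul_sum, Finset.sum_sub_distrib]
  refine mul_nonneg ha0.le ?_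
  simp
  linarith

end NormalizedResponse

/-! ### The quantizer as a normalized response; positivity of λ -/

section Response

/-- The rotation by -arctan σ, which turns the noisy measurement p.1 + σ p.2 into √(1 + σ²) p.1. -/
lemma measurePreserving_rotation_stdNormal (σ : ℝ) :
    MeasurePreserving (fun p : ℝ × ℝ => ((√(1 + σ ^ 2))⁻¹ * p.1 - σ / √(1 + σ ^ 2) * p.2,
      σ / √(1 + σ ^ 2) * p.1 + (√(1 + σ ^ 2))⁻¹ * p.2))
      (stdNormal.prod stdNormal) (stdNormal.prod stdNormal) := by
  refine ⟨by fun_prop, ?_⟩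
  have h := IsGaussian.map_rotation_eq_self (μ := stdNormal) (by simp) (-Real.arctan σ)
  convert h using 2
  ext p <;> simp [ContinuousLinearMap.rotation_apply, Real.cos_arctan, Real.sin_arctan]
  ring

lemma map_noisy_stdNormal (σ : ℝ) :
    (stdNormal.prod stdNormal).map (fun p : ℝ × ℝ => p.1 + σ * p.2)
      = stdNormal.map (fun x => √(1 + σ ^ 2) * x) := by
  have hs : √(1 + σ ^ 2) ^ 2 = 1 + σ ^ 2 := Real.sq_sqrt (by positivity)
  have hs0 : 0 < √(1 + σ ^ 2) := Real.sqrt_pos.2 (by positivity)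
  have h1 : stdNormal.map (fun x => √(1 + σ ^ 2) * x) =
      (stdNormal.prod stdNormal).map (fun p : ℝ × ℝ => √(1 + σ ^ 2) * p.1) := by
    conv_lhs => rw [← (measurePreserving_fst (μ := stdNormal) (ν := stdNormal)).map_eq]
    rw [Measure.map_map (by fun_prop) (by fun_prop)]
    rfl
  rw [h1]
  conv_lhs => rw [← (measurePreserving_rotation_stdNormal σ).map_eq]
  rw [Measure.map_map (by fun_prop) (by fun_prop)]
  congr 1
  ext p
  simp only [Function.comp_apply]
  field_simp
  rw [hs]; ring

variable {b : ℕ} (Q : Quantizer b) (σ : ℝ)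

lemma Psi_eq : Psi Q σ = √(∫ x, Q.quantize (√(1 + σ ^ 2) * x) ^ 2 ∂stdNormal) := by
  have hm := measurable_quantize Q
  have h1 := integral_map (μ := stdNormal.prod stdNormal) (φ := fun p : ℝ × ℝ => p.1 + σ * p.2)
    (by fun_prop) (f := fun z => Q.quantize z ^ 2) (by fun_prop)
  rw [map_noisy_stdNormal, integral_map (by fun_prop) (by fun_prop)] at h1
  rw [Psi, h1]
  rfl

lemma integrable_quantize_pow (c : ℝ) (k : ℕ) :
    Integrable (fun x => Q.quantize (c * x) ^ k) stdNormal := by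
  have hm := measurable_quantize Q
  refine Integrable.of_bound (Measurable.aestronglyMeasurable (by fun_prop)) ((∑ k, Q.μ k) ^ k)
    (ae_of_all _ fun x => ?_)
  rw [norm_pow]
  exact pow_le_pow_left₀ (norm_nonneg _) (abs_quantize_le Q _) k

lemma Psi_pos : 0 < Psi Q σ := by
  have hs0 : 0 < √(1 + σ ^ 2) := Real.sqrt_pos.2 (by positivity)
  have := nullSingletonClass_gaussianReal (μ := 0) (v := 1) one_ne_zero
  rw [Psi_eq, Real.sqrt_pos, integral_pos_iff_support_of_nonneg (fun _ => sq_nonneg _)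
    (integrable_quantize_pow Q _ 2)]
  have hsub : {(0 : ℝ)}ᶜ ⊆ Function.support fun x => Q.quantize (√(1 + σ ^ 2) * x) ^ 2 :=
    fun x hx => pow_ne_zero 2 (quantize_ne_zero Q (mul_ne_zero hs0.ne' hx))
  refine lt_of_lt_of_le ?_ (measure_mono hsub)
  rw [prob_compl_eq_one_sub (measurableSet_singleton _), measure_singleton]
  simp

lemma integral_quantize_sq :
    ∫ x, Q.quantize (√(1 + σ ^ 2) * x) ^ 2 ∂stdNormal = Psi Q σ ^ 2 := by
  rw [Psi_eq, Real.sq_sqrt (integral_nonneg fun _ => sq_nonneg _)]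

/-- The normalized observation as a function of the standardized noisy linear measurement. -/
noncomputable def standardResponse {b : ℕ} (Q : Quantizer b) (σ x : ℝ) : ℝ :=
  Q.quantize (√(1 + σ ^ 2) * x) / Psi Q σ

lemma measurable_standardResponse : Measurable (standardResponse Q σ) := by
  have hm := measurable_quantize Q
  unfold standardResponse
  fun_prop

lemma abs_standardResponse_le (x : ℝ) :
    |standardResponse Q σ x| ≤ (∑ k, Q.μ k) / Psi Q σ := by
  rw [standardResponse, abs_div, abs_of_pos (Psi_pos Q σ)]
  exact div_le_div_of_nonneg_right (abs_quantize_le Q _) (Psi_pos Q σ).le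

lemma integral_standardResponse_sq : ∫ x, standardResponse Q σ x ^ 2 ∂stdNormal = 1 := by
  simp only [standardResponse, div_pow]
  rw [integral_div, integral_quantize_sq, div_self (pow_ne_zero 2 (Psi_pos Q σ).ne')]

lemma integrable_exp_standardResponse (L : ℝ) :
    Integrable (fun x => Real.exp (standardResponse Q σ x ^ 2 / L ^ 2)) stdNormal := by
  have hm := measurable_standardResponse Q σ
  refine Integrable.of_bound (by fun_prop) (Real.exp (((∑ k, Q.μ k) / Psi Q σ) ^ 2 / L ^ 2))
    (ae_of_all _ fun x => ?_)
  rw [Real.norm_eq_abs, Real.abs_exp]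
  refine Real.exp_le_exp.2 (div_le_div_of_nonneg_right ?_ (sq_nonneg _))
  exact sq_le_sq' (abs_le.1 (abs_standardResponse_le Q σ x)).1
    (abs_le.1 (abs_standardResponse_le Q σ x)).2

lemma obsSubGaussianNorm_eq : obsSubGaussianNorm Q σ =
    sInf {L : ℝ | 0 < L ∧ ∫ x, Real.exp (standardResponse Q σ x ^ 2 / L ^ 2) ∂stdNormal ≤ 2} := by
  rw [obsSubGaussianNorm, subGaussianNorm]
  congr 1
  ext L
  refine and_congr_right fun _ => ?_
  have hm := measurable_quantize Q
  have h1 := lintegral_map (μ := stdNormal.prod stdNormal) (g := fun p : ℝ × ℝ => p.1 + σ * p.2)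
    (f := fun z => ENNReal.ofReal (Real.exp ((Q.quantize z / Psi Q σ) ^ 2 / L ^ 2)))
    (by fun_prop) (by fun_prop)
  rw [map_noisy_stdNormal, lintegral_map (by fun_prop) (by fun_prop)] at h1
  have h2 := ofReal_integral_eq_lintegral_ofReal (integrable_exp_standardResponse Q σ L)
    (ae_of_all _ fun _ => (Real.exp_pos _).le)
  have h3 : ∫⁻ p, ENNReal.ofReal (Real.exp ((singleObs Q σ p / Psi Q σ) ^ 2 / L ^ 2))
      ∂(stdNormal.prod stdNormal) =
      ENNReal.ofReal (∫ x, Real.exp (standardResponse Q σ x ^ 2 / L ^ 2) ∂stdNormal) :=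
    h1.symm.trans h2.symm
  rw [h3, ENNReal.ofReal_le_ofNat]

lemma normalizedResponse :
    NormalizedResponse (standardResponse Q σ) (obsSubGaussianNorm Q σ) := by
  have hΨ := Psi_pos Q σ
  set S := {L : ℝ | 0 < L ∧ ∫ x, Real.exp (standardResponse Q σ x ^ 2 / L ^ 2) ∂stdNormal ≤ 2}
    with hS
  have hLeq : obsSubGaussianNorm Q σ = sInf S := obsSubGaussianNorm_eq Q σ
  -- Since exp u ≥ 1 + u and the second moment is 1, an admissible L satisfies 1 + 1/L² ≤ 2.
  have hmem1 : ∀ L ∈ S, 1 ≤ L := fun L ⟨hL, h⟩ => by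
    have hi2 : Integrable (fun x => standardResponse Q σ x ^ 2) stdNormal := by
      simp only [standardResponse, div_pow]
      exact (integrable_quantize_pow Q _ 2).div_const _
    have hint := integral_mono ((hi2.div_const (L ^ 2)).add (integrable_const 1))
      (integrable_exp_standardResponse Q σ L) fun x => Real.add_one_le_exp _
    rw [integral_add' (hi2.div_const (L ^ 2)) (integrable_const 1), integral_div,
      integral_standardResponse_sq] at hint
    simp only [integral_const, probReal_univ, smul_eq_mul, mul_one] at hint
    have h1 : 1 / L ^ 2 ≤ 1 := by linarith
    rw [div_le_one (by positivity)] at h1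
    nlinarith
  have hne : S.Nonempty := by
    set B := (∑ k, Q.μ k) / Psi Q σ with hB
    refine ⟨2 * |B| + 1, by positivity, ?_⟩
    have hb : ∀ x, Real.exp (standardResponse Q σ x ^ 2 / (2 * |B| + 1) ^ 2) ≤ 2 := fun x => by
      have h1 : standardResponse Q σ x ^ 2 / (2 * |B| + 1) ^ 2 ≤ 1 / 4 := by
        rw [div_le_iff₀ (by positivity), ← sq_abs (standardResponse Q σ x)]
        have := (abs_standardResponse_le Q σ x).trans (le_abs_self B)
        nlinarith [abs_nonneg (standardResponse Q σ x)]
      have h2 : Real.exp (1 / 4) ^ 4 = Real.exp 1 := by rw [← Real.exp_nat_mul]; norm_num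
      refine (Real.exp_le_exp.2 h1).trans ?_
      by_contra! h3
      have : (2 : ℝ) ^ 4 ≤ Real.exp (1 / 4) ^ 4 := pow_le_pow_left₀ (by norm_num) h3.le 4
      linarith [Real.exp_one_lt_d9]
    refine (integral_mono (integrable_exp_standardResponse Q σ _) (integrable_const 2) hb).trans ?_
    simp
  have h1 : 1 ≤ obsSubGaussianNorm Q σ := hLeq ▸ le_csInf hne hmem1
  refine ⟨measurable_standardResponse Q σ, ⟨_, abs_standardResponse_le Q σ⟩, h1,
    integral_standardResponse_sq Q σ, ?_, fun x => ?_⟩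
  -- Attainment of the infimum is not needed: some admissible L lies below twice the infimum, hence
  -- the factor 2 in `NormalizedResponse`.
  · obtain ⟨L, ⟨hL0, hL⟩, hlt⟩ := exists_lt_of_csInf_lt hne
      (show sInf S < 2 * obsSubGaussianNorm Q σ by rw [← hLeq]; linarith)
    refine (integral_mono (integrable_exp_standardResponse Q σ _)
      (integrable_exp_standardResponse Q σ L) fun x => Real.exp_le_exp.2 ?_).trans hL
    gcongr
  · have hs0 : 0 < √(1 + σ ^ 2) := Real.sqrt_pos.2 (by positivity)
    have h2 : standardResponse Q σ x * x =
        Q.quantize (√(1 + σ ^ 2) * x) * (√(1 + σ ^ 2) * x) / (Psi Q σ * √(1 + σ ^ 2)) := by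
      rw [standardResponse]; field_simp
    rw [h2]
    exact div_nonneg (quantize_mul_self_nonneg Q _) (by positivity)

/-- After the rotation g becomes (N - σ N') / s with N' independent of N, and the observation
depends on N only; the centred N' term integrates to zero. -/
lemma lam_eq : lam Q σ =
    Psi Q σ / √(1 + σ ^ 2) * ∫ x, standardResponse Q σ x * x ∂stdNormal := by
  have hs0 : 0 < √(1 + σ ^ 2) := Real.sqrt_pos.2 (by positivity)
  have hm := measurable_quantize Q
  have hid : Integrable (fun x : ℝ => x) stdNormal := by simpa using integrable_pow_stdNormal 1
  have hbd : ∀ z, ‖Q.quantize z‖ ≤ ∑ k, Q.μ k := abs_quantize_le Q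
  have hint : Integrable (fun p : ℝ × ℝ => Q.quantize (p.1 + σ * p.2) * p.1)
      (stdNormal.prod stdNormal) :=
    (hid.comp_fst _).bdd_mul (c := ∑ k, Q.μ k) (Measurable.aestronglyMeasurable (by fun_prop))
      (ae_of_all _ fun _ => hbd _)
  have h1 : lam Q σ = ∫ p, Q.quantize (p.1 + σ * p.2) * p.1 ∂(stdNormal.prod stdNormal) := by
    rw [integral_prod _ hint, lam]
    simp only [theta, integral_mul_const]
  set s := √(1 + σ ^ 2) with hs
  have hs2 : s ^ 2 = 1 + σ ^ 2 := Real.sq_sqrt (by positivity)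
  have h2 := integral_map (μ := stdNormal.prod stdNormal)
    (measurePreserving_rotation_stdNormal σ).measurable.aemeasurable
    (f := fun p : ℝ × ℝ => Q.quantize (p.1 + σ * p.2) * p.1) (by fun_prop)
  rw [(measurePreserving_rotation_stdNormal σ).map_eq, ← h1, ← hs] at h2
  have e : ∀ p : ℝ × ℝ, (s⁻¹ * p.1 - σ / s * p.2) + σ * (σ / s * p.1 + s⁻¹ * p.2) = s * p.1 :=
    fun p => by field_simp; rw [hs2]; ring
  simp only [e] at h2
  have i1 : Integrable (fun p : ℝ × ℝ => s⁻¹ * (Q.quantize (s * p.1) * p.1))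
      (stdNormal.prod stdNormal) :=
    ((hid.comp_fst _).bdd_mul (c := ∑ k, Q.μ k) (Measurable.aestronglyMeasurable (by fun_prop))
     
      (ae_of_all _ fun _ => hbd _)).const_mul _
  have i2 : Integrable (fun p : ℝ × ℝ => σ / s * (Q.quantize (s * p.1) * p.2))
      (stdNormal.prod stdNormal) :=
    ((hid.comp_snd _).bdd_mul (c := ∑ k, Q.μ k) (Measurable.aestronglyMeasurable (by fun_prop))
     
      (ae_of_all _ fun _ => hbd _)).const_mul _
  have h3 : lam Q σ = ∫ p, (s⁻¹ * (Q.quantize (s * p.1) * p.1)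
      - σ / s * (Q.quantize (s * p.1) * p.2)) ∂(stdNormal.prod stdNormal) := by
    rw [h2]; congr 1; ext p; ring
  rw [h3, integral_sub i1 i2, integral_const_mul, integral_const_mul,
    integral_prod_mul (fun x => Q.quantize (s * x)) (fun y => y), integral_id_gaussianReal,
    integral_fun_fst (μ := stdNormal) (ν := stdNormal) (fun x => Q.quantize (s * x) * x)]
  have h4 : ∀ x, standardResponse Q σ x * x = (Psi Q σ)⁻¹ * (Q.quantize (s * x) * x) :=
    fun x => by rw [standardResponse]; ring
  simp_rw [h4]
  rw [integral_const_mul]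
  have := Psi_pos Q σ
  simp
  field_simp

lemma lam_pos : 0 < lam Q σ := by
  rw [lam_eq]
  have hs0 : 0 < √(1 + σ ^ 2) := Real.sqrt_pos.2 (by positivity)
  exact mul_pos (div_pos (Psi_pos Q σ) hs0) (normalizedResponse Q σ).integral_mul_self_pos

end Response

/-! ### Characteristic functions of products of Gaussian laws -/

section GaussianLaws

variable {E : Type*} [NormedAddCommGroup E] [InnerProductSpace ℝ E] [FiniteDimensional ℝ E]
  [MeasurableSpace E] [BorelSpace E]

lemma stdGaussian_real : stdGaussian ℝ = stdNormal := by
  refine Measure.ext_of_charFun (funext fun t => ?_)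
  rw [charFun_stdGaussian, charFun_gaussianReal]
  simp [← Complex.ofReal_pow]
  ring_nf

lemma integral_cexp_sum_inner_pi_stdGaussian {m : ℕ} (β : Fin m → E) :
    ∫ G : Fin m → E, Complex.exp ((∑ i, ⟪G i, β i⟫ : ℝ) * Complex.I)
      ∂(Measure.pi fun _ => stdGaussian E) = Complex.exp (-(∑ i, ‖β i‖ ^ 2 : ℝ) / 2) := by
  simp_rw [Complex.ofReal_sum, Finset.sum_mul, Complex.exp_sum]
  rw [integral_fintype_prod_eq_prod (f := fun i (g : E) => Complex.exp (⟪g, β i⟫ * Complex.I))]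
  simp_rw [← charFun_apply, charFun_stdGaussian]
  rw [← Complex.exp_sum, ← Finset.sum_div, Finset.sum_neg_distrib]
  push_cast
  rfl

/-- A linear combination of independent standard Gaussian vectors is a rescaled one. -/
lemma map_sum_smul_pi_stdGaussian {m : ℕ} (y : Fin m → ℝ) :
    (Measure.pi fun _ : Fin m => stdGaussian E).map (fun G => ∑ i, y i • G i) =
      (stdGaussian E).map (fun g => √(∑ i, y i ^ 2) • g) := by
  refine Measure.ext_of_charFun (funext fun t => ?_)
  rw [charFun_map_smul, charFun_stdGaussian, charFun_apply,
    integral_map (Measurable.aemeasurable (by fun_prop))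
    (Measurable.aestronglyMeasurable (by fun_prop))]
  have h := integral_cexp_sum_inner_pi_stdGaussian (fun i => y i • t)
  simp only [real_inner_smul_right] at h
  simp only [sum_inner, real_inner_smul_left]
  rw [h]
  have hsum : ∑ i, ‖y i • t‖ ^ 2 = ‖√(∑ i, y i ^ 2) • t‖ ^ 2 := by
    rw [norm_smul, mul_pow, Real.norm_eq_abs, sq_abs, Real.sq_sqrt
      (Finset.sum_nonneg fun i _ => sq_nonneg _), Finset.sum_mul]
    refine Finset.sum_congr rfl fun i _ => ?_
    rw [norm_smul, mul_pow, Real.norm_eq_abs, sq_abs]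
  rw [hsum]
  push_cast
  rfl

lemma integral_cexp_prod_pi_stdGaussian {m : ℕ} (α : Fin m → ℝ) (β : Fin m → E) :
    ∫ p : (Fin m → ℝ) × (Fin m → E),
      Complex.exp ((∑ i, p.1 i * α i + ∑ i, ⟪p.2 i, β i⟫ : ℝ) * Complex.I)
      ∂((Measure.pi fun _ => stdNormal).prod (Measure.pi fun _ => stdGaussian E)) =
      Complex.exp (-(∑ i, (α i ^ 2 + ‖β i‖ ^ 2) : ℝ) / 2) := by
  have h1 := integral_cexp_sum_inner_pi_stdGaussian α
  rw [stdGaussian_real] at h1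
  simp_rw [Complex.ofReal_add, add_mul, Complex.exp_add]
  rw [integral_prod_mul (fun N : Fin m → ℝ => Complex.exp ((∑ i, N i * α i : ℝ) * Complex.I))
    (fun G : Fin m → E => Complex.exp ((∑ i, ⟪G i, β i⟫ : ℝ) * Complex.I)),
    integral_cexp_sum_inner_pi_stdGaussian]
  simp only [RCLike.inner_apply, conj_trivial] at h1
  simp_rw [mul_comm (α _)] at h1
  rw [h1, ← Complex.exp_add]
  congr 1
  rw [Finset.sum_add_distrib]
  simp
  ring

/-- A measurement vector built from its standardized noisy component `N` along the signal `x` and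
an independent standard Gaussian vector `g`. -/
noncomputable def measurementRow (x : E) (σ N : ℝ) (g : E) : E :=
  (N / √(1 + σ ^ 2)) • x + dampedAlong x (σ / √(1 + σ ^ 2)) g

/-- The noise variable accompanying `measurementRow`. -/
noncomputable def measurementNoise (x : E) (σ N : ℝ) (g : E) : ℝ :=
  σ / √(1 + σ ^ 2) * N - ⟪x, g⟫ / √(1 + σ ^ 2)

end GaussianLaws

/-! ### Splitting a measurement into observed and independent parts -/

section Decomposition

variable {E : Type*} [NormedAddCommGroup E] [InnerProductSpace ℝ E]

/-- The vector g cancels, so the quantizer sees only N. -/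
lemma inner_measurementRow_add {x : E} (hx : ‖x‖ = 1) (σ N : ℝ) (g : E) :
    ⟪x, measurementRow x σ N g⟫ + σ * measurementNoise x σ N g = √(1 + σ ^ 2) * N := by
  have hs : √(1 + σ ^ 2) ^ 2 = 1 + σ ^ 2 := Real.sq_sqrt (by positivity)
  have hs0 : 0 < √(1 + σ ^ 2) := Real.sqrt_pos.2 (by positivity)
  rw [measurementRow, measurementNoise, dampedAlong, inner_add_right, inner_sub_right,
    real_inner_smul_right, real_inner_smul_right, real_inner_self_eq_norm_sq, hx]
  field_simp
  rw [hs]; ring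

lemma norm_sq_dampedAlong_sub {x : E} (hx : ‖x‖ = 1) (ρ c : ℝ) (t : E) :
    ‖dampedAlong x ρ t - c • x‖ ^ 2 = ‖t‖ ^ 2 - ⟪x, t⟫ ^ 2 + (ρ * ⟪x, t⟫ - c) ^ 2 := by
  have : dampedAlong x ρ t - c • x = t - ((1 - ρ) * ⟪x, t⟫ + c) • x := by
    rw [dampedAlong]; module
  rw [this, norm_sub_sq_real, real_inner_smul_right, norm_smul, hx, real_inner_comm,
    mul_one, Real.norm_eq_abs, sq_abs]
  ring

lemma inner_measurementRow_add_noise (x : E) (σ N : ℝ) (g t : E) (τ : ℝ) :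
    ⟪measurementRow x σ N g, t⟫ + measurementNoise x σ N g * τ =
      N * ((⟪x, t⟫ + σ * τ) / √(1 + σ ^ 2)) +
      ⟪g, dampedAlong x (σ / √(1 + σ ^ 2)) t - (τ / √(1 + σ ^ 2)) • x⟫ := by
  rw [measurementRow, measurementNoise, inner_add_left, real_inner_smul_left, inner_dampedAlong,
    inner_sub_right, real_inner_smul_right, real_inner_comm _ g, real_inner_comm x g]
  ring

/-- The adjoint of (N, g) ↦ (row, noise) is isometric; this is what makes the row and the noise
jointly standard Gaussian. -/
lemma norm_sq_measurement {x : E} (hx : ‖x‖ = 1) (σ : ℝ) (t : E) (τ : ℝ) :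
    ((⟪x, t⟫ + σ * τ) / √(1 + σ ^ 2)) ^ 2 +
      ‖dampedAlong x (σ / √(1 + σ ^ 2)) t - (τ / √(1 + σ ^ 2)) • x‖ ^ 2 = ‖t‖ ^ 2 + τ ^ 2 := by
  have hs : √(1 + σ ^ 2) ^ 2 = 1 + σ ^ 2 := Real.sq_sqrt (by positivity)
  have hs0 : 0 < √(1 + σ ^ 2) := Real.sqrt_pos.2 (by positivity)
  rw [norm_sq_dampedAlong_sub hx]
  field_simp
  rw [hs]; ring

end Decomposition

/-! ### Law of the reconstructed ensemble -/

section EnsembleLaw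

variable {m n : ℕ}

/-- The entries of the measurement matrix and of the noise, built from the independent variables of
`measurementRow` and `measurementNoise`. -/
noncomputable def ensembleOf (x : EuclideanSpace ℝ (Fin n)) (σ : ℝ)
    (p : (Fin m → ℝ) × (Fin m → EuclideanSpace ℝ (Fin n))) : (Fin m × Fin n) ⊕ Fin m → ℝ :=
  Sum.elim (fun ij => measurementRow x σ (p.1 ij.1) (p.2 ij.1) ij.2)
    fun i => measurementNoise x σ (p.1 i) (p.2 i)

lemma measurable_ensembleOf (x : EuclideanSpace ℝ (Fin n)) (σ : ℝ) :
    Measurable (ensembleOf (m := m) x σ) := by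
  refine measurable_pi_lambda _ fun k => ?_
  rcases k with ij | i
  · simp only [ensembleOf, Sum.elim_inl, measurementRow, dampedAlong]
    fun_prop
  · simp only [ensembleOf, Sum.elim_inr, measurementNoise]
    fun_prop

lemma map_ensembleOf {x : EuclideanSpace ℝ (Fin n)} (hx : ‖x‖ = 1) (σ : ℝ) :
    ((Measure.pi fun _ : Fin m => stdNormal).prod
      (Measure.pi fun _ => stdGaussian (EuclideanSpace ℝ (Fin n)))).map (ensembleOf x σ) =
      Measure.pi fun _ => stdNormal := by
  have hm := measurable_ensembleOf (m := m) x σ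
  have : IsProbabilityMeasure (((Measure.pi fun _ : Fin m => stdNormal).prod
      (Measure.pi fun _ => stdGaussian (EuclideanSpace ℝ (Fin n)))).map (ensembleOf x σ)) :=
    Measure.isProbabilityMeasure_map hm.aemeasurable
  refine charFun_eq_pi_iff.1 fun t => ?_
  set u : Fin m → EuclideanSpace ℝ (Fin n) := fun i => WithLp.toLp 2 fun j => t (Sum.inl (i, j))
    with hu
  set τ : Fin m → ℝ := fun i => t (Sum.inr i) with hτ
  rw [Measure.map_map (by fun_prop) hm, charFun_apply,
    integral_map (Measurable.aemeasurable (by fun_prop))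
    (Measurable.aestronglyMeasurable (by fun_prop))]
  have hinner : ∀ p : (Fin m → ℝ) × (Fin m → EuclideanSpace ℝ (Fin n)),
      ⟪(WithLp.toLp 2 ∘ ensembleOf x σ) p, t⟫ =
        ∑ i, p.1 i * ((⟪x, u i⟫ + σ * τ i) / √(1 + σ ^ 2)) +
        ∑ i, ⟪p.2 i, dampedAlong x (σ / √(1 + σ ^ 2)) (u i) - (τ i / √(1 + σ ^ 2)) • x⟫ := by
    intro p
    rw [← Finset.sum_add_distrib]
    simp_rw [← inner_measurementRow_add_noise]
    rw [PiLp.inner_apply, Fintype.sum_sum_type, Fintype.sum_prod_type, ← Finset.sum_add_distrib]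
    refine Finset.sum_congr rfl fun i _ => ?_
    rw [PiLp.inner_apply]
    simp [ensembleOf, hu, hτ, mul_comm]
  simp_rw [hinner, integral_cexp_prod_pi_stdGaussian, norm_sq_measurement hx,
    charFun_gaussianReal]
  rw [← Complex.exp_sum]
  congr 1
  rw [Fintype.sum_sum_type, Fintype.sum_prod_type, ← Finset.sum_add_distrib]
  push_cast
  rw [neg_div, Finset.sum_div, ← Finset.sum_neg_distrib]
  refine Finset.sum_congr rfl fun i _ => ?_
  have h1 : (‖u i‖ : ℂ) ^ 2 = ∑ j, (t (Sum.inl (i, j)) : ℂ) ^ 2 := by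
    have := EuclideanSpace.real_norm_sq_eq (u i)
    rw [← Complex.ofReal_pow, this]
    push_cast
    rfl
  rw [h1, add_div, neg_add, Finset.sum_div, ← Finset.sum_neg_distrib]
  congr 1
  · refine Finset.sum_congr rfl fun j _ => ?_
    simp
  · simp [hτ]

lemma hasLaw_ensemble {Ω : Type*} [MeasurableSpace Ω] {P : Measure Ω}
    {A : Ω → Matrix (Fin m) (Fin n) ℝ} {ε : Ω → Fin m → ℝ} (h : IsGaussianEnsemble A ε P) :
    HasLaw (fun ω (k : (Fin m × Fin n) ⊕ Fin m) =>
      Sum.elim (fun ij => A ω ij.1 ij.2) (ε ω) k) (Measure.pi fun _ => stdNormal) P := by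
  have hl : ∀ k : (Fin m × Fin n) ⊕ Fin m,
      HasLaw (fun ω => Sum.elim (fun ij => A ω ij.1 ij.2) (ε ω) k) stdNormal P := fun k => by
    rcases k with ij | i
    · exact h.law_A ij.1 ij.2
    · exact h.law_ε i
  refine ⟨aemeasurable_pi_lambda _ fun k => (hl k).aemeasurable, ?_⟩
  rw [h.indep.map_fun_eq_pi_map fun k => (hl k).aemeasurable]
  congr 1
  ext1 k
  exact (hl k).map_eq

end EnsembleLaw

/-! ### Deterministic error bound -/

section Estimator

variable {n : ℕ}

/-- With u = xhat - x, optimality gives ⟨η, u⟩ ≥ 0, and ‖xhat‖ ≤ 1 = ‖x‖ gives -2⟨x, u⟩ ≥ ‖u‖².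
Hence (l/4)‖u‖² ≤ -Λ⟨x, u⟩ ≤ ⟨η - Λ x, u⟩ ≤ r‖u‖. No convexity of K enters. -/
lemma norm_sub_le_of_mem_linearEstimators {K : Set (EuclideanSpace ℝ (Fin n))}
    {x xhat η : EuclideanSpace ℝ (Fin n)} (hx : ‖x‖ = 1) (hxK : x ∈ K) {Λ l r : ℝ} (hl : 0 < l)
    (hΛ : l / 2 ≤ Λ) (hr : 0 ≤ r)
    (hη : ∀ v ∈ sphericalTangentCone (feasibleSet K) x, |⟪η - Λ • x, v⟫| ≤ r)
    (h : xhat ∈ linearEstimators (feasibleSet K) η) :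
    ‖xhat - x‖ ≤ 4 * r / l := by
  obtain ⟨hC, hmin⟩ := h
  have hxC : x ∈ feasibleSet K := ⟨hxK, by simp [hx]⟩
  set u := xhat - x with hu
  rcases eq_or_ne u 0 with h0 | h0
  · rw [h0, norm_zero]; positivity
  have hu0 : 0 < ‖u‖ := norm_pos_iff.2 h0
  have hv : ‖u‖⁻¹ • u ∈ sphericalTangentCone (feasibleSet K) x :=
    ⟨⟨‖u‖⁻¹, by positivity, xhat, hC, rfl⟩, by simp [norm_smul, hu0.ne']⟩
  have h1 := hη _ hv
  rw [real_inner_smul_right, abs_mul, abs_of_pos (inv_pos.2 hu0), inv_mul_le_iff₀ hu0] at h1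
  have h2 : 0 ≤ ⟪η, u⟫ := by
    have := isMinOn_iff.1 hmin x hxC
    rw [hu, inner_sub_right]; linarith
  have h3 : ‖xhat‖ ≤ 1 := by simpa using hC.2
  have h4 : 2 * ⟪x, u⟫ ≤ -‖u‖ ^ 2 := by
    have e : xhat = x + u := by rw [hu]; abel
    have := norm_add_sq_real x u
    rw [← e, hx] at this
    nlinarith [norm_nonneg xhat]
  have h5 : ⟪η - Λ • x, u⟫ = ⟪η, u⟫ - Λ * ⟪x, u⟫ := by
    rw [inner_sub_left, real_inner_smul_left]
  have h6 := (le_abs_self _).trans h1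
  rw [h5] at h6
  have h7 : l / 4 * ‖u‖ ^ 2 ≤ ‖u‖ * r := by
    nlinarith [mul_le_mul_of_nonneg_right hΛ (sq_nonneg ‖u‖)]
  rw [le_div_iff₀ hl]
  have h8 : ‖u‖ * (l / 4 * ‖u‖) ≤ ‖u‖ * r := by linarith
  have := le_of_mul_le_mul_left h8 hu0
  linarith

end Estimator

/-! ### Signal coefficient and residual -/

section Residual

variable {b m n : ℕ} (Q : Quantizer b) (σ : ℝ) (x : EuclideanSpace ℝ (Fin n))

/-- The coefficient of the signal in the back-projected observations. -/
noncomputable def signalCoefficient (A : Matrix (Fin m) (Fin n) ℝ) (ε : Fin m → ℝ) : ℝ :=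
  (m : ℝ)⁻¹ * ∑ i, observations Q σ x A ε i * ((A *ᵥ x.ofLp) i + σ * ε i) / (1 + σ ^ 2)

/-- The part of the back-projected observations that is not explained by the signal. -/
noncomputable def obsResidual (A : Matrix (Fin m) (Fin n) ℝ) (ε : Fin m → ℝ) :
    EuclideanSpace ℝ (Fin n) :=
  eta A (observations Q σ x A ε) - signalCoefficient Q σ x A ε • x

/-- The ensembles for which the signal coefficient is large and the residual is small on `S`. -/
def goodEnsembles (S : Set (EuclideanSpace ℝ (Fin n))) (l r : ℝ) :
    Set ((Fin m × Fin n) ⊕ Fin m → ℝ) :=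
  {z | l ≤ signalCoefficient Q σ x (Matrix.of fun i j => z (Sum.inl (i, j))) (fun i => z (Sum.inr i)) ∧
    ∀ v ∈ S, |⟪obsResidual Q σ x (Matrix.of fun i j => z (Sum.inl (i, j))) (fun i => z (Sum.inr i)), v⟫| ≤ r}

lemma measurable_observations : Measurable fun z : (Fin m × Fin n) ⊕ Fin m → ℝ =>
    observations Q σ x (Matrix.of fun i j => z (Sum.inl (i, j))) (fun i => z (Sum.inr i)) := by
  refine measurable_pi_lambda _ fun i => (measurable_quantize Q).comp ?_
  simp only [Matrix.mulVec, dotProduct, Matrix.of_apply]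
  fun_prop

lemma measurable_signalCoefficient : Measurable fun z : (Fin m × Fin n) ⊕ Fin m → ℝ =>
    signalCoefficient Q σ x (Matrix.of fun i j => z (Sum.inl (i, j))) (fun i => z (Sum.inr i)) := by
  have h := measurable_observations (m := m) Q σ x
  have h2 : ∀ i, Measurable fun z : (Fin m × Fin n) ⊕ Fin m → ℝ =>
    observations Q σ x (Matrix.of fun i j => z (Sum.inl (i, j))) (fun i => z (Sum.inr i)) i :=
    fun i => (measurable_pi_apply i).comp h
  simp only [signalCoefficient, Matrix.mulVec, dotProduct, Matrix.of_apply]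
  fun_prop

lemma measurable_obsResidual : Measurable fun z : (Fin m × Fin n) ⊕ Fin m → ℝ =>
    obsResidual Q σ x (Matrix.of fun i j => z (Sum.inl (i, j))) (fun i => z (Sum.inr i)) := by
  have h := measurable_observations (m := m) Q σ x
  have h2 : ∀ i, Measurable fun z : (Fin m × Fin n) ⊕ Fin m → ℝ =>
    observations Q σ x (Matrix.of fun i j => z (Sum.inl (i, j))) (fun i => z (Sum.inr i)) i :=
    fun i => (measurable_pi_apply i).comp h
  refine Measurable.sub ?_ ((measurable_signalCoefficient Q σ x).smul_const x)
  refine (WithLp.measurable_toLp 2 (Fin n → ℝ)).comp (measurable_pi_lambda _ fun j => ?_)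
  simp only [Pi.smul_apply, Matrix.mulVec, dotProduct, Matrix.transpose_apply, Matrix.of_apply,
    smul_eq_mul]
  fun_prop

lemma measurableSet_goodEnsembles (S : Set (EuclideanSpace ℝ (Fin n))) (l r : ℝ) :
    MeasurableSet (goodEnsembles (m := m) Q σ x S l r) := by
  refine (measurableSet_le measurable_const (measurable_signalCoefficient Q σ x)).inter ?_
  have hcl : IsClosed {g : EuclideanSpace ℝ (Fin n) | ∀ v ∈ S, |⟪g, v⟫| ≤ r} := by
    have : {g : EuclideanSpace ℝ (Fin n) | ∀ v ∈ S, |⟪g, v⟫| ≤ r} =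
        ⋂ v ∈ S, {g | |⟪g, v⟫| ≤ r} := by ext; simp
    rw [this]
    exact isClosed_biInter fun v _ => isClosed_le (by fun_prop) continuous_const
  exact measurable_obsResidual Q σ x hcl.measurableSet

variable {x}

lemma observations_ensembleOf (hx : ‖x‖ = 1)
    (p : (Fin m → ℝ) × (Fin m → EuclideanSpace ℝ (Fin n))) (i : Fin m) :
    ((Matrix.of fun i j => ensembleOf x σ p (Sum.inl (i, j))) *ᵥ x.ofLp) i
      + σ * ensembleOf x σ p (Sum.inr i) = √(1 + σ ^ 2) * p.1 i := by
  rw [← inner_measurementRow_add hx σ (p.1 i) (p.2 i)]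
  congr 1

lemma signalCoefficient_ensembleOf (hx : ‖x‖ = 1)
    (p : (Fin m → ℝ) × (Fin m → EuclideanSpace ℝ (Fin n))) :
    signalCoefficient Q σ x (Matrix.of fun i j => ensembleOf x σ p (Sum.inl (i, j)))
      (fun i => ensembleOf x σ p (Sum.inr i)) =
      Psi Q σ / (m * √(1 + σ ^ 2)) * ∑ i, standardResponse Q σ (p.1 i) * p.1 i := by
  have hs : √(1 + σ ^ 2) ^ 2 = 1 + σ ^ 2 := Real.sq_sqrt (by positivity)
  have hs0 : 0 < √(1 + σ ^ 2) := Real.sqrt_pos.2 (by positivity)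
  have hΨ := Psi_pos Q σ
  simp only [signalCoefficient, observations, observations_ensembleOf σ hx]
  rw [Finset.mul_sum, Finset.mul_sum]
  refine Finset.sum_congr rfl fun i _ => ?_
  rw [standardResponse]
  set s := √(1 + σ ^ 2)
  rw [← hs]
  field_simp

/-- The x-parts N / √(1 + σ²) of the rows add up to exactly the signal coefficient; what remains is
linear in the Gaussian vectors, with weights independent of them. -/
lemma obsResidual_ensembleOf (hx : ‖x‖ = 1)
    (p : (Fin m → ℝ) × (Fin m → EuclideanSpace ℝ (Fin n))) :
    obsResidual Q σ x (Matrix.of fun i j => ensembleOf x σ p (Sum.inl (i, j)))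
      (fun i => ensembleOf x σ p (Sum.inr i)) =
      (Psi Q σ / m) • dampedAlong x (σ / √(1 + σ ^ 2))
        (∑ i, standardResponse Q σ (p.1 i) • p.2 i) := by
  have hΨ := Psi_pos Q σ
  have hobs : observations Q σ x (Matrix.of fun i j => ensembleOf x σ p (Sum.inl (i, j)))
      (fun i => ensembleOf x σ p (Sum.inr i)) =
      fun i => Psi Q σ * standardResponse Q σ (p.1 i) := by
    ext i
    simp only [observations, observations_ensembleOf σ hx]
    rw [standardResponse]
    field_simp
  ext j
  rw [obsResidual, signalCoefficient_ensembleOf Q σ hx, hobs]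
  simp only [eta, dampedAlong, PiLp.sub_apply, PiLp.smul_apply, smul_eq_mul,
    Pi.smul_apply, Matrix.mulVec, dotProduct, Matrix.transpose_apply, Matrix.of_apply, inner_sum,
    real_inner_smul_right, WithLp.ofLp_sum, Finset.sum_apply, mul_sub, Finset.mul_sum,
    Finset.sum_mul]
  rw [← Finset.sum_sub_distrib, ← Finset.sum_sub_distrib]
  refine Finset.sum_congr rfl fun i _ => ?_
  simp [ensembleOf, measurementRow, dampedAlong]
  ring

end Residual

/-! ### Tail bound for the residual -/

section Probability

variable {E : Type*} [NormedAddCommGroup E] [InnerProductSpace ℝ E] [FiniteDimensional ℝ E]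
  [MeasurableSpace E] [BorelSpace E]

/-- Conditionally on the scalar variables the weighted sum is a scaled standard Gaussian vector; the
scale factors out by homogeneity. -/
lemma measure_exists_dampedAlong_sum_gt_le {m : ℕ} {f : ℝ → ℝ} (hf : Measurable f) {x : E}
    (hx : ‖x‖ = 1) {ρ : ℝ} (h0 : 0 ≤ ρ) (h1 : ρ ≤ 1) {S : Set E} (hS : ∀ v ∈ S, ‖v‖ ≤ 1) {w : ℝ}
    (hw : ∫ g, ⨆ v : S, |⟪g, (v : E)⟫| ∂(stdGaussian E) = w) :
    ((Measure.pi fun _ : Fin m => stdNormal).prod (Measure.pi fun _ => stdGaussian E))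
      {p | ∃ v ∈ S, 4 * w * √(∑ i, f (p.1 i) ^ 2) <
        |⟪dampedAlong x ρ (∑ i, f (p.1 i) • p.2 i), v⟫|} ≤ ENNReal.ofReal (Real.exp (1 - w)) := by
  have hcont : Continuous (dampedAlong x ρ) := by unfold dampedAlong; fun_prop
  have hopen : IsOpen {q : ℝ × E | ∃ v ∈ S, 4 * w * q.1 < |⟪dampedAlong x ρ q.2, v⟫|} := by
    have : {q : ℝ × E | ∃ v ∈ S, 4 * w * q.1 < |⟪dampedAlong x ρ q.2, v⟫|} =
        ⋃ v ∈ S, {q | 4 * w * q.1 < |⟪dampedAlong x ρ q.2, v⟫|} := by ext; simp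
    rw [this]
    exact isOpen_biUnion fun v _ => isOpen_lt (by fun_prop) (by fun_prop)
  have hmap : Measurable fun p : (Fin m → ℝ) × (Fin m → E) =>
      (√(∑ i, f (p.1 i) ^ 2), ∑ i, f (p.1 i) • p.2 i) := by fun_prop
  have hmeas : MeasurableSet {p : (Fin m → ℝ) × (Fin m → E) | ∃ v ∈ S,
      4 * w * √(∑ i, f (p.1 i) ^ 2) < |⟪dampedAlong x ρ (∑ i, f (p.1 i) • p.2 i), v⟫|} :=
    hmap hopen.measurableSet
  rw [Measure.prod_apply hmeas]
  calc _ ≤ ∫⁻ _ : Fin m → ℝ, ENNReal.ofReal (Real.exp (1 - w))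
        ∂(Measure.pi fun _ : Fin m => stdNormal) := by
        refine lintegral_mono fun N => ?_
        set c := √(∑ i, f (N i) ^ 2) with hc
        have hc0 : 0 ≤ c := Real.sqrt_nonneg _
        have hset : MeasurableSet {g : E | ∃ v ∈ S, 4 * w * c < |⟪dampedAlong x ρ g, v⟫|} :=
          (hopen.preimage (show Continuous fun g : E => (c, g) by fun_prop)).measurableSet
        have e1 : (Measure.pi fun _ : Fin m => stdGaussian E)
            {G | ∃ v ∈ S, 4 * w * c < |⟪dampedAlong x ρ (∑ i, f (N i) • G i), v⟫|} =
            stdGaussian E {g | ∃ v ∈ S, 4 * w * c < |⟪dampedAlong x ρ (c • g), v⟫|} := by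
          have e2 := congrArg (fun μ => μ {g : E | ∃ v ∈ S, 4 * w * c < |⟪dampedAlong x ρ g, v⟫|})
            (map_sum_smul_pi_stdGaussian (E := E) fun i => f (N i))
          rwa [Measure.map_apply (by fun_prop) hset, Measure.map_apply (by fun_prop) hset] at e2
        refine e1.le.trans ((measure_mono ?_).trans
          (hw ▸ measure_exists_dampedAlong_gt_le hx h0 h1 hS))
        rintro g ⟨v, hv, hlt⟩
        refine ⟨v, hv, ?_⟩
        have e3 : dampedAlong x ρ (c • g) = c • dampedAlong x ρ g := by
          simp only [dampedAlong, real_inner_smul_right]; module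
        rw [e3, real_inner_smul_left, abs_mul, abs_of_nonneg hc0, mul_comm] at hlt
        exact lt_of_mul_lt_mul_left hlt hc0
    _ = _ := by simp

end Probability

/-! ### Assembling the error bound -/

section ErrorBound

variable {b m n : ℕ} (Q : Quantizer b) {σ : ℝ} {x : EuclideanSpace ℝ (Fin n)}

lemma measure_compl_goodEnsembles_le (hσ : 0 ≤ σ) (hx : ‖x‖ = 1) (hm : 1 ≤ m)
    {S : Set (EuclideanSpace ℝ (Fin n))} (hS : ∀ v ∈ S, ‖v‖ ≤ 1) :
    (Measure.pi fun _ => stdNormal).real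
      (goodEnsembles (m := m) Q σ x S (lam Q σ / 2) (6 * Psi Q σ * gaussianWidth S / √m))ᶜ ≤
      Real.exp (1 - gaussianWidth S) +
        2 * Real.exp (-(1 / (10 ^ 12 * obsSubGaussianNorm Q σ ^ 16) * m)) := by
  set w := gaussianWidth S with hw
  set c := 1 / (10 ^ 12 * obsSubGaussianNorm Q σ ^ 16) with hc
  set p := standardResponse Q σ with hp
  have hresp := normalizedResponse Q σ
  have hΨ := Psi_pos Q σ
  have hm0 : (0 : ℝ) < m := by exact_mod_cast hm
  have hs0 : 0 < √(1 + σ ^ 2) := Real.sqrt_pos.2 (by positivity)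
  have hρ0 : 0 ≤ σ / √(1 + σ ^ 2) := by positivity
  have hρ1 : σ / √(1 + σ ^ 2) ≤ 1 := by
    rw [div_le_one hs0]
    exact Real.le_sqrt_of_sq_le (by linarith)
  have hw0 : 0 ≤ w := integral_nonneg fun g => iSup_abs_inner_nonneg S g
  set Γ := (Measure.pi fun _ : Fin m => stdNormal).prod
    (Measure.pi fun _ : Fin m => stdGaussian (EuclideanSpace ℝ (Fin n))) with hΓ
  set B₁ : Set (Fin m → ℝ) := {N | ∑ i, p (N i) * N i ≤ m * (∫ x, p x * x ∂stdNormal) / 2}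
    with hB₁
  set B₂ : Set (Fin m → ℝ) := {N | 9 / 4 * m ≤ ∑ i, p (N i) ^ 2} with hB₂
  set B₃ : Set ((Fin m → ℝ) × (Fin m → EuclideanSpace ℝ (Fin n))) :=
    {q | ∃ v ∈ S, 4 * w * √(∑ i, p (q.1 i) ^ 2) <
        |⟪dampedAlong x (σ / √(1 + σ ^ 2)) (∑ i, p (q.1 i) • q.2 i), v⟫|} with hB₃
  have hpm : Measurable p := hresp.measurable
  have hB₁m : MeasurableSet B₁ := measurableSet_le (by fun_prop) measurable_const
  have hB₂m : MeasurableSet B₂ := measurableSet_le measurable_const (by fun_prop)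
  have hfst : MeasurePreserving Prod.fst Γ (Measure.pi fun _ : Fin m => stdNormal) :=
    measurePreserving_fst
  have h1 : Γ.real (Prod.fst ⁻¹' B₁) ≤ Real.exp (-(c * m)) := by
    rw [hfst.measureReal_preimage hB₁m.nullMeasurableSet]
    exact hresp.measure_sum_mul_self_le m
  have h2 : Γ.real (Prod.fst ⁻¹' B₂) ≤ Real.exp (-(c * m)) := by
    rw [hfst.measureReal_preimage hB₂m.nullMeasurableSet]
    exact hresp.measure_sum_sq_le m
  have h3 : Γ.real B₃ ≤ Real.exp (1 - w) :=
    ENNReal.toReal_le_of_le_ofReal (Real.exp_pos _).le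
      (measure_exists_dampedAlong_sum_gt_le hpm hx hρ0 hρ1 hS rfl)
  have hsub : ensembleOf x σ ⁻¹' (goodEnsembles (m := m) Q σ x S (lam Q σ / 2)
      (6 * Psi Q σ * w / √m))ᶜ ⊆ B₃ ∪ (Prod.fst ⁻¹' B₁ ∪ Prod.fst ⁻¹' B₂) := by
    intro q hq
    by_contra hcon
    simp only [Set.mem_union, not_or] at hcon
    obtain ⟨n3, n1, n2⟩ := hcon
    refine hq ⟨?_, fun v hv => ?_⟩
    · rw [signalCoefficient_ensembleOf Q σ hx, lam_eq]
      have n1 : m * (∫ x, p x * x ∂stdNormal) / 2 < ∑ i, p (q.1 i) * q.1 i := not_le.1 n1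
      calc _ = Psi Q σ / (m * √(1 + σ ^ 2)) * (m * (∫ x, p x * x ∂stdNormal) / 2) := by
            rw [hp]; field_simp
        _ ≤ _ := by gcongr
    · rw [obsResidual_ensembleOf Q σ hx, real_inner_smul_left, abs_mul,
        abs_of_nonneg (by positivity)]
      have n3 : |⟪dampedAlong x (σ / √(1 + σ ^ 2)) (∑ i, p (q.1 i) • q.2 i), v⟫| ≤
          4 * w * √(∑ i, p (q.1 i) ^ 2) := by
        by_contra hlt
        exact n3 ⟨v, hv, not_le.1 hlt⟩
      have n2 : ∑ i, p (q.1 i) ^ 2 < 9 / 4 * m := not_le.1 n2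
      -- The threshold 9/4 is (3/2)², whence 4w · (3/2)√m = 6w√m.
      have n4 : √(∑ i, p (q.1 i) ^ 2) ≤ 3 / 2 * √m := by
        refine Real.sqrt_le_iff.2 ⟨by positivity, ?_⟩
        rw [mul_pow, Real.sq_sqrt hm0.le]
        linarith
      have hsm0 : 0 < √(m : ℝ) := Real.sqrt_pos.2 hm0
      calc _ ≤ Psi Q σ / m * (4 * w * (3 / 2 * √m)) := by
            gcongr
            exact n3.trans (by gcongr)
        _ = _ := by
            field_simp
            rw [Real.sq_sqrt hm0.le]; ring
  have hmeas := (measurableSet_goodEnsembles (m := m) Q σ x S (lam Q σ / 2)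
    (6 * Psi Q σ * w / √m)).compl
  rw [← map_ensembleOf hx σ, map_measureReal_apply (measurable_ensembleOf x σ) hmeas]
  calc _ ≤ Γ.real (B₃ ∪ (Prod.fst ⁻¹' B₁ ∪ Prod.fst ⁻¹' B₂)) := measureReal_mono hsub
    _ ≤ Γ.real B₃ + (Γ.real (Prod.fst ⁻¹' B₁) + Γ.real (Prod.fst ⁻¹' B₂)) :=
        (measureReal_union_le _ _).trans (by gcongr; exact measureReal_union_le _ _)
    _ ≤ _ := by linarith

/-- The non-asymptotic error bound for the canonical linear estimators. -/
lemma exists_event_norm_sub_le (hσ : 0 ≤ σ) {K : Set (EuclideanSpace ℝ (Fin n))} (hx : ‖x‖ = 1)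
    (hxK : x ∈ K) (hm : 1 ≤ m) {Ω : Type*} [MeasurableSpace Ω] {P : Measure Ω}
    [IsProbabilityMeasure P] {A : Ω → Matrix (Fin m) (Fin n) ℝ} {ε : Ω → Fin m → ℝ}
    (h : IsGaussianEnsemble A ε P) :
    ∃ E : Set Ω, MeasurableSet E ∧
      1 - 4 * (Real.exp (-(coneWidth K x) / 2)
        + Real.exp (-(1 / (10 ^ 12 * obsSubGaussianNorm Q σ ^ 16) * m))) ≤ P.real E ∧
      ∀ ω ∈ E, ∀ xhat ∈ linearEstimators (feasibleSet K)
          (eta (A ω) (observations Q σ x (A ω) (ε ω))),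
        ‖xhat - x‖ ≤ 24 * (Psi Q σ / lam Q σ) * (coneWidth K x / √m) := by
  set S := sphericalTangentCone (feasibleSet K) x with hS
  have hw : coneWidth K x = gaussianWidth S := rfl
  set w := gaussianWidth S with hw'
  have hw0 : 0 ≤ w := integral_nonneg fun g => iSup_abs_inner_nonneg S g
  have hS1 : ∀ v ∈ S, ‖v‖ ≤ 1 := fun v hv => by simpa using hv.2.le
  set B := goodEnsembles (m := m) Q σ x S (lam Q σ / 2) (6 * Psi Q σ * w / √m) with hB
  have hBm : MeasurableSet B := measurableSet_goodEnsembles Q σ x S _ _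
  have hlaw := hasLaw_ensemble h
  -- The ensemble is only a.e. measurable, so the good event is replaced by a measurable subset of
  -- equal probability.
  obtain ⟨E, hEB, hEm, hEae⟩ :=
    (hlaw.aemeasurable.nullMeasurableSet_preimage hBm).exists_measurable_subset_ae_eq
  refine ⟨E, hEm, ?_, fun ω hω xhat hxhat => ?_⟩
  · have h1 : P.real E = (Measure.pi fun _ => stdNormal).real B :=
      (measureReal_congr hEae).trans (hlaw.measureReal_eq hBm)
    have h2 := measure_compl_goodEnsembles_le Q hσ hx hm hS1
    rw [probReal_compl_eq_one_sub hBm] at h2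
    -- Uses w ≥ 0 and e < 4.
    have h3 : Real.exp (1 - w) ≤ 4 * Real.exp (-w / 2) := by
      have h4 : Real.exp (1 - w) ≤ Real.exp 1 * Real.exp (-w / 2) := by
        rw [← Real.exp_add]
        exact Real.exp_le_exp.2 (by linarith)
      nlinarith [Real.exp_one_lt_d9, Real.exp_pos (-w / 2)]
    rw [h1, hw]
    linarith [Real.exp_pos (-(1 / (10 ^ 12 * obsSubGaussianNorm Q σ ^ 16) * (m : ℝ)))]
  · obtain ⟨hΛ, hR⟩ := hEB hω
    have hΨ := Psi_pos Q σ
    have hl := lam_pos Q σ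
    -- The constant 24 is 4 · 6.
    refine (norm_sub_le_of_mem_linearEstimators hx hxK hl hΛ (by positivity) hR hxhat).trans
      (le_of_eq ?_)
    rw [hw]
    ring

end ErrorBound

theorem theorem1 :
    ∃ c : ℝ → ℝ, (∀ L, 0 < c L) ∧
      ∀ (b : ℕ) (_ : 1 ≤ b) (Q : Quantizer b) (σ : ℝ) (_ : 0 ≤ σ),
        0 < lam Q σ ∧
        ∀ (K : ∀ n : ℕ, Set (EuclideanSpace ℝ (Fin n))) (x : ∀ n : ℕ, EuclideanSpace ℝ (Fin n))
          (m : ℕ → ℕ) (Ω : ℕ → Type*) [∀ n, MeasurableSpace (Ω n)] (P : ∀ n, Measure (Ω n))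
          [∀ n, IsProbabilityMeasure (P n)]
          (A : ∀ n, Ω n → Matrix (Fin (m n)) (Fin n) ℝ) (ε : ∀ n, Ω n → Fin (m n) → ℝ),
          (∀ n, 1 ≤ n → x n ∈ K n ∧ ‖x n‖ = 1) →
          (∀ n, 1 ≤ n → 1 ≤ m n) →
          (∀ n, 1 ≤ n → IsGaussianEnsemble (A n) (ε n) (P n)) →
          Tendsto (fun n => ⨆ j, |x n j|) atTop (𝓝 0) →
          (∀ᶠ n in atTop, ∃ E : Set (Ω n), MeasurableSet E ∧
            1 - 4 * (Real.exp (-(coneWidth (K n) (x n)) / 2)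
                + Real.exp (-(c (obsSubGaussianNorm Q σ) * m n))) ≤ (P n).real E ∧
            ∀ ω ∈ E, ∀ xhat ∈ linearEstimators (feasibleSet (K n))
                (eta (A n ω) (observations Q σ (x n) (A n ω) (ε n ω))),
              ‖xhat - x n‖ ≤
                24 * (Psi Q σ / lam Q σ) * (coneWidth (K n) (x n) / √(m n))) ∧
          (Tendsto (fun n => coneWidth (K n) (x n)) atTop atTop →
            ∃ δ : ℕ → ℝ, Tendsto δ atTop (𝓝 0) ∧ ∀ n,
              1 - 4 * (Real.exp (-(coneWidth (K n) (x n)) / 2)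
                + Real.exp (-(c (obsSubGaussianNorm Q σ) * m n)))
              = 1 - δ n - 4 * Real.exp (-(c (obsSubGaussianNorm Q σ) * m n))) := by

  -- The maximum with 1 keeps the rate positive for every real L; it changes nothing at an actual
  -- sub-Gaussian norm, which is at least 1.
  refine ⟨fun L => 1 / (10 ^ 12 * max L 1 ^ 16), fun L => by positivity, ?_⟩
  intro b _ Q σ hσ
  refine ⟨lam_pos Q σ, ?_⟩
  intro K x m Ω _ P _ A ε hx hm hA _
  have hL : max (obsSubGaussianNorm Q σ) 1 = obsSubGaussianNorm Q σ :=
    max_eq_left (normalizedResponse Q σ).one_le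
  simp only [hL]
  refine ⟨?_, fun hw => ⟨fun n => 4 * Real.exp (-(coneWidth (K n) (x n)) / 2), ?_,
    fun n => by ring⟩⟩
  · filter_upwards [eventually_ge_atTop 1] with n hn
    exact exists_event_norm_sub_le Q hσ (hx n hn).2 (hx n hn).1 (hm n hn) (hA n hn)
  · have h1 : Tendsto (fun n => -(coneWidth (K n) (x n)) / 2) atTop atBot :=
      (tendsto_neg_atTop_atBot.comp hw).atBot_div_const (by norm_num)
    simpa using (Real.tendsto_exp_atBot.comp h1).const_mul 4
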